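/- **Setting.** Let $T>0$, let $(W_t)_{t\in[0,T]}$ be a one-dimensional Wiener process on a filtered probability space $(\Omega,\mathcal F,(\mathcal F_t)_{t\in[0,T]},\mathbb Q)$, let $r,\mu\in\mathbb R$, $\sigma>0$ with $\mu\ne r$, and put $\gamma=\sigma^{-1}(\mu-r)$ and $\tilde Z_t=\exp\left(-(r+\tfrac12\gamma^2)t-\gamma W_t\right)$. Let $v_0>0$, and let $m\in[0,1]$, $\alpha\in(0,1]$, $c\in[0,1]$ with $c<1+m$ (that is, $(m,c)\neq(0,1)$) be a first-loss fee structure. If the terminal value of the fund is $v\ge 0$, the investor receives $$I(v)=\begin{cases} v+v_0(c-m), & v-mv_0<(1-c)v_0,\\ v_0, & (1-c)v_0\le v-mv_0<v_0,\\ v-mv_0-\alpha(v-(1+m)v_0), & v-mv_0\ge v_0,\end{cases}$$ and the manager receives $M(v)=v-I(v)$. For $P\in\{M,I\}$ let $\tilde U_P(x)=\frac1{1-b_P}(x+a_P)^{1-b_P}$ be a HARA utility function with $b_P>0$, $b_P\ne1$, where $a_M\ge v_0(c-m)$ if $b_M<1$, $a_M>v_0(c-m)$ if $b_M>1$, $a_I\ge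 v_0(m-c)$ if $b_I<1$, and $a_I>v_0(m-c)$ if $b_I>1$. Put $U_M(v)=\tilde U_M(M(v))$ and $U_I(v)=\tilde U_I(I(v))$. The fund's optimal terminal value $V_T^*$ is a maximizer of $\mathbb E[U_M(V)]$ over all $\mathcal F_T$-measurable $V\ge0$ with $\mathbb E[\tilde Z_TV]\le v_0$, and the investor's value function is $\phi_I(m,\alpha,c)=\mathbb E[U_I(V_T^*)]$. Put $$H=\frac{(mv_0+a_M)^{1-b_M}-(v_0(m-c)+a_M)^{1-b_M}}{(1-b_M)(1+m)v_0},$$ and, with the convention $0^{-b_M}=+\infty$, distinguish * Case A: $H<\alpha(mv_0+a_M)^{-b_M}$; * Case B: $\alpha(mv_0+a_M)^{-b_M}\le H\le(mv_0+a_M)^{-b_M}$; * Case C: $(mv_0+a_M)^{-b_M}<H$. Write $$I_3(x)=\alpha^{1/b_M-1}x^{-1/b_M}+(1+m-\alpha^{-1}m)v_0-\alpha^{-1}a_M,\qquad I_2(x)=x^{-1/b_M}+v_0-a_M.$$ For $y>0$ define $V^X(y)$, $X\in\{A,B,C\}$, and the numbers occurring in it as follows. * Case A: $\theta^A$ is the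 solution $v\in((1+m)v_0,\infty)$ of $$(\alpha v+(m-\alpha(1+m))v_0+a_M)^{-b_M}(b_M\alpha v+(m-\alpha(1+m))v_0+a_M)=(v_0(m-c)+a_M)^{1-b_M},$$ $s^A=\alpha(\alpha\theta^A+(m-\alpha(1+m))v_0+a_M)^{-b_M}$, and $V^A(y)=I_3(y\tilde Z_T)\mathbb 1_{\{\tilde Z_T\in(0,s^A/y]\}}$. * Case B: $s^B=H$, and, with $q=\alpha(mv_0+a_M)^{-b_M}$, $$V^B(y)=I_3(y\tilde Z_T)\mathbb 1_{\{\tilde Z_T\in(0,q/y)\}}+(1+m)v_0\,\mathbb 1_{\{\tilde Z_T\in[q/y,\,s^B/y]\}}.$$ * Case C: $\theta^C$ is the solution $v\in((1+m-c)v_0,(1+m)v_0)$ of $$(v-v_0+a_M)^{-b_M}(b_Mv-v_0+a_M)=(v_0(m-c)+a_M)^{1-b_M},$$ $s^C=(\theta^C-v_0+a_M)^{-b_M}$, and, with $q=\alpha(mv_0+a_M)^{-b_M}$ and $q'=(mv_0+a_M)^{-b_M}$, $$V^C(y)=I_3(y\tilde Z_T)\mathbb 1_{\{\tilde Z_T\in(0,q/y)\}}+(1+m)v_0\,\mathbb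 1_{\{\tilde Z_T\in[q/y,\,q'/y)\}}+I_2(y\tilde Z_T)\mathbb 1_{\{\tilde Z_T\in(q'/y,\,s^C/y]\}}.$$ Let $\Phi$ be the standard normal distribution function and put, for $y,s>0$, $$d(y,s)=\frac{\log(y/s)-(r+\frac12\gamma^2)T}{|\gamma|\sqrt T},\qquad k=(1-\alpha)\alpha^{1/b_M-1}(y^*)^{-1/b_M},\qquad l=(1+m-\alpha^{-1}m)v_0+a_M(1-\alpha^{-1})+a_I.$$ **Proposition (investor's value function).** An optimal terminal value $V_T^*$ exists. In Cases A and C the solution $\theta^X$ exists and is unique; in each Case $X$ there is a unique $y^*>0$ with $\mathbb E[\tilde Z_TV^X(y^*)]=v_0$. For every optimal $V_T^*$ the random variable $U_I(V_T^*)$ is integrable, the truncated expectation below is finite, and $\phi_I(m,\alpha,c)=\mathbb E[U_I(V_T^*)]$ is given as follows. * Case A: $$\phi_I=\frac{(v_0(c-m)+a_I)^{1-b_I}}{1-b_I}\Phi(d(y^*,s^A))+\frac1{1-b_I}\mathbb E\left[(k\tilde Z_T^{-1/b_M}+l)^{1-b_I}\mathbb 1_{\{\tilde Z_T\in(0,s^A/y^*]\}}\right].$$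 * Cases $X=B$ and $X=C$, with $q=\alpha(mv_0+a_M)^{-b_M}$: $$\phi_I=\frac{(v_0(c-m)+a_I)^{1-b_I}}{1-b_I}\Phi(d(y^*,s^X))+\frac1{1-b_I}\mathbb E\left[(k\tilde Z_T^{-1/b_M}+l)^{1-b_I}\mathbb 1_{\{\tilde Z_T\in(0,q/y^*)\}}\right]+\frac{(v_0+a_I)^{1-b_I}}{1-b_I}\left(\Phi(d(y^*,q))-\Phi(d(y^*,s^X))\right).$$ -/

import Mathlib

open MeasureTheory ProbabilityTheory
open scoped NNReal ENNReal

noncomputable section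

namespace FirstLoss

/-- The parameters of the market, of the first-loss fee structure `(m, α, c)` and of the two
HARA utility functions. -/
structure Model where
  /-- interest rate -/
  r : ℝ
  /-- drift of the risky asset -/
  μ : ℝ
  /-- volatility of the risky asset -/
  σ : ℝ
  /-- time horizon -/
  T : ℝ≥0
  /-- initial capital of the fund -/
  v₀ : ℝ
  /-- management fee -/
  m : ℝ
  /-- performance fee -/
  α : ℝ
  /-- first-loss coverage guarantee -/
  c : ℝ
  /-- shift parameter of the manager's utility -/
  aM : ℝ
  /-- risk aversion parameter of the manager's utility -/
  bM : ℝ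
  /-- shift parameter of the investor's utility -/
  aI : ℝ
  /-- risk aversion parameter of the investor's utility -/
  bI : ℝ

namespace Model

variable (p : Model)

/-- Standing assumptions on the parameters. -/
structure Admissible : Prop where
  T_pos : 0 < p.T
  σ_pos : 0 < p.σ
  /-- the market price of risk does not vanish -/
  μ_ne : p.μ ≠ p.r
  v₀_pos : 0 < p.v₀
  m_nonneg : 0 ≤ p.m
  m_le_one : p.m ≤ 1
  α_pos : 0 < p.α
  α_le_one : p.α ≤ 1
  c_nonneg : 0 ≤ p.c
  c_le_one : p.c ≤ 1
  /-- excludes only the fee structures with `m = 0` and `c = 1` -/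
  c_lt : p.c < 1 + p.m
  bM_pos : 0 < p.bM
  bM_ne : p.bM ≠ 1
  aM_of_lt : p.bM < 1 → p.v₀ * (p.c - p.m) ≤ p.aM
  aM_of_gt : 1 < p.bM → p.v₀ * (p.c - p.m) < p.aM
  bI_pos : 0 < p.bI
  bI_ne : p.bI ≠ 1
  aI_of_lt : p.bI < 1 → p.v₀ * (p.m - p.c) ≤ p.aI
  aI_of_gt : 1 < p.bI → p.v₀ * (p.m - p.c) < p.aI

/-- Market price of risk. -/
def γ : ℝ := p.σ⁻¹ * (p.μ - p.r)

/-- The investor's terminal wealth as a function of the terminal value of the fund. -/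
def payoffI (v : ℝ) : ℝ :=
  if v - p.m * p.v₀ < (1 - p.c) * p.v₀ then v + p.v₀ * (p.c - p.m)
  else if v - p.m * p.v₀ < p.v₀ then p.v₀
  else v - p.m * p.v₀ - p.α * (v - (1 + p.m) * p.v₀)

/-- The manager's terminal wealth as a function of the terminal value of the fund. -/
def payoffM (v : ℝ) : ℝ := v - p.payoffI v

end Model

/-- HARA utility with parameters `a`, `b`. -/
def hara (a b x : ℝ) : ℝ := 1 / (1 - b) * (x + a) ^ (1 - b)

/-- Distribution function of the standard normal law. -/
def Phi (x : ℝ) : ℝ := cdf (gaussianReal 0 1) x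

variable {Ω : Type*} [mΩ : MeasurableSpace Ω]

/-- `W` is a Wiener process on the time interval `[0, T]` with respect to the filtration `ℱ`
and the probability measure `Q`. (Only the values at times `t ≤ T` matter.) -/
structure IsWienerOn (T : ℝ≥0) (ℱ : Filtration ℝ≥0 mΩ) (Q : Measure Ω) (W : ℝ≥0 → Ω → ℝ) :
    Prop where
  adapted : ∀ t ≤ T, Measurable[ℱ t] (W t)
  zero : ∀ᵐ ω ∂Q, W 0 ω = 0
  law_increment : ∀ s t : ℝ≥0, s ≤ t → t ≤ T →
    Q.map (fun ω => W t ω - W s ω) = gaussianReal 0 (t - s)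
  indep_increment : ∀ s t : ℝ≥0, s ≤ t → t ≤ T →
    Indep (MeasurableSpace.comap (fun ω => W t ω - W s ω) inferInstance) (ℱ s) Q
  continuous_paths : ∀ᵐ ω ∂Q, ContinuousOn (fun t => W t ω) (Set.Iic T)

/-- Expectation with values in `[-∞, +∞]`, `E[f⁺] - E[f⁻]`; below it is used only for random
variables that are bounded from below. -/
def extExpectation (Q : Measure Ω) (f : Ω → ℝ) : EReal :=
  ((∫⁻ ω, ENNReal.ofReal (f ω) ∂Q : ℝ≥0∞) : EReal)
    - ((∫⁻ ω, ENNReal.ofReal (-f ω) ∂Q : ℝ≥0∞) : EReal)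

namespace Model

variable (p : Model)

/-- The manager's utility as a function of the terminal value of the fund. -/
def UM (v : ℝ) : ℝ := hara p.aM p.bM (p.payoffM v)

/-- The investor's utility as a function of the terminal value of the fund. -/
def UI (v : ℝ) : ℝ := hara p.aI p.bI (p.payoffI v)

/-- State price density process. -/
def Z (W : ℝ≥0 → Ω → ℝ) (t : ℝ≥0) (ω : Ω) : ℝ :=
  Real.exp (-(p.r + 1 / 2 * p.γ ^ 2) * t - p.γ * W t ω)

/-- Feasible terminal values of the fund: `V ≥ 0` and `E[Z_T V] ≤ v₀`. -/
structure IsFeasible (ℱ : Filtration ℝ≥0 mΩ) (Q : Measure Ω) (W : ℝ≥0 → Ω → ℝ) (V : Ω → ℝ) :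
    Prop where
  measurable : Measurable[ℱ p.T] V
  nonneg : ∀ᵐ ω ∂Q, 0 ≤ V ω
  budget : ∫⁻ ω, ENNReal.ofReal (p.Z W p.T ω * V ω) ∂Q ≤ ENNReal.ofReal p.v₀

/-- `V` maximizes the manager's expected utility among all feasible terminal values. -/
def IsOptimal (ℱ : Filtration ℝ≥0 mΩ) (Q : Measure Ω) (W : ℝ≥0 → Ω → ℝ) (V : Ω → ℝ) : Prop :=
  p.IsFeasible ℱ Q W V ∧ ∀ V' : Ω → ℝ, p.IsFeasible ℱ Q W V' →
    extExpectation Q (fun ω => p.UM (V' ω)) ≤ extExpectation Q (fun ω => p.UM (V ω))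

/-! ### The three cases -/

/-- Slope of the line through `(0, U_M(0))` and `((1 + m) v₀, U_M((1 + m) v₀))`. -/
def H : ℝ :=
  ((p.m * p.v₀ + p.aM) ^ (1 - p.bM) - (p.v₀ * (p.m - p.c) + p.aM) ^ (1 - p.bM)) /
    ((1 - p.bM) * (1 + p.m) * p.v₀)

/-- The admissible parameters satisfy `m v₀ + aM ≥ 0`; if this number vanishes then its negative
power is to be read as `+∞`, so that the inequality defining Case A holds. -/
def CaseA : Prop :=
  p.m * p.v₀ + p.aM = 0 ∨ p.H < p.α * (p.m * p.v₀ + p.aM) ^ (-p.bM)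

/-- Case B. -/
def CaseB : Prop :=
  p.m * p.v₀ + p.aM ≠ 0 ∧ p.α * (p.m * p.v₀ + p.aM) ^ (-p.bM) ≤ p.H ∧
    p.H ≤ (p.m * p.v₀ + p.aM) ^ (-p.bM)

/-- Case C. -/
def CaseC : Prop :=
  p.m * p.v₀ + p.aM ≠ 0 ∧ (p.m * p.v₀ + p.aM) ^ (-p.bM) < p.H

/-- The equation for the concavification point `θ` in Case A. -/
def IsThetaA (θ : ℝ) : Prop :=
  (1 + p.m) * p.v₀ < θ ∧
    (p.α * θ + (p.m - p.α * (1 + p.m)) * p.v₀ + p.aM) ^ (-p.bM) *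
      (p.bM * p.α * θ + (p.m - p.α * (1 + p.m)) * p.v₀ + p.aM) =
        (p.v₀ * (p.m - p.c) + p.aM) ^ (1 - p.bM)

/-- The equation for the concavification point `θ` in Case C. -/
def IsThetaC (θ : ℝ) : Prop :=
  (1 + p.m - p.c) * p.v₀ < θ ∧ θ < (1 + p.m) * p.v₀ ∧
    (θ - p.v₀ + p.aM) ^ (-p.bM) * (p.bM * θ - p.v₀ + p.aM) =
      (p.v₀ * (p.m - p.c) + p.aM) ^ (1 - p.bM)

/-- The slope `s(θ)` in Case A. -/
def slopeA (θ : ℝ) : ℝ :=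
  p.α * (p.α * θ + (p.m - p.α * (1 + p.m)) * p.v₀ + p.aM) ^ (-p.bM)

/-- The slope `s(θ)` in Case C. -/
def slopeC (θ : ℝ) : ℝ := (θ - p.v₀ + p.aM) ^ (-p.bM)

/-- Inverse of the manager's marginal utility above `(1 + m) v₀`, at `y z`. -/
def inv₃ (y z : ℝ) : ℝ :=
  p.α ^ (1 / p.bM - 1) * (y * z) ^ (-1 / p.bM) + (1 + p.m - p.α⁻¹ * p.m) * p.v₀ - p.α⁻¹ * p.aM

/-- Inverse of the manager's marginal utility between `(1 + m - c) v₀` and `(1 + m) v₀`,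
at `y z`. -/
def inv₂ (y z : ℝ) : ℝ := (y * z) ^ (-1 / p.bM) + p.v₀ - p.aM

/-- Terminal value of the fund in Case A as a function of the multiplier `y` and of the state
price density `z`. -/
def valueA (θ y z : ℝ) : ℝ :=
  (Set.Ioc 0 (p.slopeA θ / y)).indicator (p.inv₃ y) z

/-- Terminal value of the fund in Case B. -/
def valueB (y z : ℝ) : ℝ :=
  (Set.Ioo 0 (p.α * (p.m * p.v₀ + p.aM) ^ (-p.bM) / y)).indicator (p.inv₃ y) z
    + (Set.Icc (p.α * (p.m * p.v₀ + p.aM) ^ (-p.bM) / y) (p.H / y)).indicator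
        (fun _ => (1 + p.m) * p.v₀) z

/-- Terminal value of the fund in Case C. -/
def valueC (θ y z : ℝ) : ℝ :=
  (Set.Ioo 0 (p.α * (p.m * p.v₀ + p.aM) ^ (-p.bM) / y)).indicator (p.inv₃ y) z
    + (Set.Ico (p.α * (p.m * p.v₀ + p.aM) ^ (-p.bM) / y)
        ((p.m * p.v₀ + p.aM) ^ (-p.bM) / y)).indicator (fun _ => (1 + p.m) * p.v₀) z
    + (Set.Ioc ((p.m * p.v₀ + p.aM) ^ (-p.bM) / y) (p.slopeC θ / y)).indicator (p.inv₂ y) z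

/-- `y > 0` solves the budget equation `E[Z_T v(y, Z_T)] = v₀`. -/
def IsMultiplier (Q : Measure Ω) (W : ℝ≥0 → Ω → ℝ) (v : ℝ → ℝ → ℝ) (y : ℝ) : Prop :=
  0 < y ∧ Integrable (fun ω => p.Z W p.T ω * v y (p.Z W p.T ω)) Q ∧
    ∫ ω, p.Z W p.T ω * v y (p.Z W p.T ω) ∂Q = p.v₀

/-! ### The ingredients of the formulas -/

/-- The number `(log (y / s) - (r + γ² / 2) T) / (|γ| √T)`. -/
def d (y s : ℝ) : ℝ :=
  (Real.log (y / s) - (p.r + 1 / 2 * p.γ ^ 2) * p.T) / (|p.γ| * Real.sqrt p.T)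

/-- The constant `k`. -/
def k (y : ℝ) : ℝ := (1 - p.α) * p.α ^ (1 / p.bM - 1) * y ^ (-1 / p.bM)

/-- The constant `l`. -/
def l : ℝ := (1 + p.m - p.α⁻¹ * p.m) * p.v₀ + p.aM * (1 - p.α⁻¹) + p.aI

/-- The random variable `(k Z_T ^ (-1 / bM) + l) ^ (1 - bI) · 1{Z_T ∈ A}`. -/
def truncated (W : ℝ≥0 → Ω → ℝ) (y : ℝ) (A : Set ℝ) (ω : Ω) : ℝ :=
  A.indicator (fun z => (p.k y * z ^ (-1 / p.bM) + p.l) ^ (1 - p.bI)) (p.Z W p.T ω)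

/-- For every optimal terminal value `V` of the fund, the investor's expected utility
`E[U_I(V)]` exists and equals `x`. -/
def InvestorValueEq (ℱ : Filtration ℝ≥0 mΩ) (Q : Measure Ω) (W : ℝ≥0 → Ω → ℝ) (x : ℝ) : Prop :=
  ∀ V : Ω → ℝ, p.IsOptimal ℱ Q W V →
    Integrable (fun ω => p.UI (V ω)) Q ∧ ∫ ω, p.UI (V ω) ∂Q = x

end Model

end FirstLoss

end

/-! The manager's problem is solved by Lagrangian duality, without forming the concave envelope of
`UM`. For a price `x > 0`, let `g x` be a maximizer of `UM v - x * v` over `v ≥ 0`. If the budget of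
`g (y * Z)` equals `v₀`, integrating the pointwise inequality `UM V - y Z V ≤ UM (g (y Z)) - y Z g
(y Z)` shows that `g (y * Z)` beats every feasible `V`. An optimal `V` must attain equality almost
surely, so it too is a pointwise maximizer.

Maximizers decrease in the price, so `g` has only countably many discontinuities, and at a point of
continuity the maximizer is unique. As the law of `Z` has no atoms, the optimum is almost surely
unique. The same facts make the budget continuous in `y`; it is also strictly decreasing and crosses
`v₀`, which yields the multiplier (`existsUnique_budget_eq`, `IsOptimal.ae_eq_demand`).

It remains to find `g`. Above the flat region the argument of the power utility is concave in `v`,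
with slope `1` and then `α`, so supergradients certify the maximizers `inv₃`, the kink `(1 + m) v₀`,
and `inv₂`. Demand drops to `0` at the price `s` at which the best point above the flat region is
worth exactly `UM 0`: this `s` is the slope of the line from `(0, UM 0)` supporting the graph. That
line touches it beyond the kink, at it or before it, which gives Cases A, B and C. The tangency
equation becomes an equation for the monotone function `tangentIntercept`.

The investor's value then follows by splitting the range of `y * Z` at `q` and `s` and using that
`log Z` is Gaussian. -/

open Filter Topology

/-! ### Abstract price densities and demand functions -/

namespace FirstLoss

/-- A positive random variable whose law is atomless, charges every open subinterval of `(0, ∞)`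
and has moments of all real orders. -/
structure IsPriceDensity {Ω : Type*} [MeasurableSpace Ω] (Q : Measure Ω) (Z : Ω → ℝ) : Prop where
  measurable : Measurable Z
  pos : ∀ ω, 0 < Z ω
  noAtom : ∀ x, Q {ω | Z ω = x} = 0
  moment : ∀ e : ℝ, Integrable (fun ω => Z ω ^ e) Q
  charges : ∀ a b, a < b → 0 < b → 0 < Q {ω | a < Z ω ∧ Z ω < b}

/-- For every price `x > 0` the quantity `g x` maximizes `U v - x v` over `v ≥ 0`; it vanishes
exactly above the threshold `s`, and it explodes at most polynomially at `0`. -/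
structure IsDemand (U g : ℝ → ℝ) (s : ℝ) : Prop where
  threshold_pos : 0 < s
  measurable_utility : Measurable U
  measurable : Measurable g
  utility_zero_le : ∀ v, 0 ≤ v → U 0 ≤ U v
  nonneg : ∀ x, 0 < x → 0 ≤ g x
  isMax : ∀ x, 0 < x → ∀ v, 0 ≤ v → U v - x * v ≤ U (g x) - x * g x
  pos : ∀ x, 0 < x → x < s → 0 < g x
  zero : ∀ x, s < x → g x = 0
  growth : ∃ C D e : ℝ, ∀ x, 0 < x → g x ≤ C * x ^ e + D
  explodes : Tendsto g (𝓝[>] 0) atTop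

namespace IsDemand

variable {U g : ℝ → ℝ} {s : ℝ}

/-- Adding the optimality of `g x` at price `x` to that of `v` at price `x'` cancels the utilities
and leaves `(x' - x) * (v - g x) ≤ 0`. Here `v` may be any maximizer at `x'`, not just `g x'`; this
generality gives uniqueness below. -/
theorem le_of_isMax (h : IsDemand U g s) {x x' v : ℝ} (hx : 0 < x) (hlt : x < x')
    (hv : 0 ≤ v) (hmax : U (g x') - x' * g x' ≤ U v - x' * v) : v ≤ g x := by
  have h1 := h.isMax x hx v hv
  have h2 := h.isMax x' (hx.trans hlt) (g x) (h.nonneg x hx)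
  have h3 : (x' - x) * (v - g x) ≤ 0 := by nlinarith
  by_contra hc
  push Not at hc
  nlinarith [mul_pos (sub_pos.2 hlt) (sub_pos.2 hc)]

theorem ge_of_isMax (h : IsDemand U g s) {x x' v : ℝ} (hx : 0 < x) (hlt : x < x')
    (hv : 0 ≤ v) (hmax : U (g x) - x * g x ≤ U v - x * v) : g x' ≤ v := by
  have hx' := hx.trans hlt
  have h1 := h.isMax x' hx' v hv
  have h2 := h.isMax x hx (g x') (h.nonneg x' hx')
  by_contra hc
  push Not at hc
  nlinarith [mul_pos (sub_pos.2 hlt) (sub_pos.2 hc)]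

theorem antitoneOn (h : IsDemand U g s) : AntitoneOn g (Set.Ioi 0) := by
  intro x hx y hy hxy
  rcases hxy.eq_or_lt with rfl | hlt
  · exact le_rfl
  · exact h.le_of_isMax hx hlt (h.nonneg y hy) le_rfl

theorem countable_not_continuousAt (h : IsDemand U g s) :
    {x | 0 < x ∧ ¬ ContinuousAt g x}.Countable := by
  refine h.antitoneOn.countable_not_continuousWithinAt.mono ?_
  rintro x ⟨hx, hc⟩
  exact ⟨hx, fun hw => hc (hw.continuousAt (Ioi_mem_nhds hx))⟩

/-- Where the demand function is continuous, the maximizer is unique. -/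
theorem eq_of_isMax (h : IsDemand U g s) {x v : ℝ} (hx : 0 < x) (hc : ContinuousAt g x)
    (hv : 0 ≤ v) (hmax : U (g x) - x * g x ≤ U v - x * v) : v = g x := by
  -- Any maximizer at `x` lies below the values of `g` to the left of `x` and above those to the
  -- right, and both one-sided limits equal `g x`.
  apply le_antisymm
  · have ht : Tendsto g (𝓝[<] x) (𝓝 (g x)) := hc.tendsto.mono_left nhdsWithin_le_nhds
    refine ge_of_tendsto ht ?_
    filter_upwards [Ioo_mem_nhdsLT hx] with y hy
    exact h.le_of_isMax hy.1 hy.2 hv hmax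
  · have ht : Tendsto g (𝓝[>] x) (𝓝 (g x)) := hc.tendsto.mono_left nhdsWithin_le_nhds
    refine le_of_tendsto ht ?_
    filter_upwards [self_mem_nhdsWithin] with y hy
    exact h.ge_of_isMax hx hy hv hmax

end IsDemand

namespace IsPriceDensity

variable {Ω : Type*} [MeasurableSpace Ω] {Q : Measure Ω} {Z : Ω → ℝ}

theorem integrable (hZ : IsPriceDensity Q Z) : Integrable Z Q := by
  simpa using hZ.moment 1

theorem ae_mul_notMem (hZ : IsPriceDensity Q Z) {y : ℝ} (hy : 0 < y) {N : Set ℝ}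
    (hN : N.Countable) : ∀ᵐ ω ∂Q, y * Z ω ∉ N := by
  have : ∀ᵐ ω ∂Q, ∀ x ∈ N, Z ω ≠ x / y := by
    rw [ae_ball_iff hN]
    intro x _
    rw [ae_iff]
    simpa using hZ.noAtom (x / y)
  filter_upwards [this] with ω hω hmem
  exact hω _ hmem (by field_simp)

theorem ae_mul_ne (hZ : IsPriceDensity Q Z) {y : ℝ} (hy : 0 < y) (x : ℝ) :
    ∀ᵐ ω ∂Q, y * Z ω ≠ x := by
  simpa using hZ.ae_mul_notMem hy (Set.countable_singleton x)

theorem ae_continuousAt (hZ : IsPriceDensity Q Z) {U g : ℝ → ℝ} {s y : ℝ} (h : IsDemand U g s)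
    (hy : 0 < y) : ∀ᵐ ω ∂Q, ContinuousAt g (y * Z ω) := by
  filter_upwards [hZ.ae_mul_notMem hy h.countable_not_continuousAt] with ω hω
  by_contra hc
  exact hω ⟨mul_pos hy (hZ.pos ω), hc⟩

end IsPriceDensity

/-! ### The budget as a function of the multiplier -/

namespace IsDemand

variable {Ω : Type*} [MeasurableSpace Ω] {Q : Measure Ω} {Z : Ω → ℝ}
  {U g : ℝ → ℝ} {s : ℝ}

theorem measurable_comp (h : IsDemand U g s) (hZ : IsPriceDensity Q Z) (y : ℝ) :
    Measurable (fun ω => g (y * Z ω)) :=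
  h.measurable.comp (hZ.measurable.const_mul y)

theorem integrable_comp [IsFiniteMeasure Q] (h : IsDemand U g s) (hZ : IsPriceDensity Q Z) {y : ℝ} (hy : 0 < y) :
    Integrable (fun ω => g (y * Z ω)) Q := by
  obtain ⟨C, D, e, hg⟩ := h.growth
  have hi : Integrable (fun ω => C * (y ^ e * Z ω ^ e) + D) Q :=
    (((hZ.moment e).const_mul _).const_mul _).add (integrable_const D)
  refine hi.mono' (h.measurable_comp hZ y).aestronglyMeasurable (ae_of_all _ fun ω => ?_)
  have hp := mul_pos hy (hZ.pos ω)
  rw [Real.norm_of_nonneg (h.nonneg _ hp), ← Real.mul_rpow hy.le (hZ.pos ω).le]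
  exact hg _ hp

theorem integrable_mul_comp (h : IsDemand U g s) (hZ : IsPriceDensity Q Z) {y : ℝ}
    (hy : 0 < y) : Integrable (fun ω => Z ω * g (y * Z ω)) Q := by
  obtain ⟨C, D, e, hg⟩ := h.growth
  have hi : Integrable (fun ω => C * (y ^ e * Z ω ^ (1 + e)) + D * Z ω) Q :=
    (((hZ.moment (1 + e)).const_mul _).const_mul _).add (hZ.integrable.const_mul D)
  refine hi.mono' (hZ.measurable.mul (h.measurable_comp hZ y)).aestronglyMeasurable
    (ae_of_all _ fun ω => ?_)
  have hp := mul_pos hy (hZ.pos ω)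
  rw [Real.norm_of_nonneg (mul_nonneg (hZ.pos ω).le (h.nonneg _ hp)),
    Real.rpow_add (hZ.pos ω), Real.rpow_one]
  have := mul_le_mul_of_nonneg_left (hg _ hp) (hZ.pos ω).le
  rw [Real.mul_rpow hy.le (hZ.pos ω).le] at this
  linarith

theorem comp_le (h : IsDemand U g s) (hZ : IsPriceDensity Q Z) {y y' : ℝ} (hy : 0 < y)
    (hyy' : y ≤ y') (ω : Ω) : Z ω * g (y' * Z ω) ≤ Z ω * g (y * Z ω) := by
  have hz := hZ.pos ω
  exact mul_le_mul_of_nonneg_left (h.antitoneOn (mul_pos hy hz)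
    (mul_pos (hy.trans_le hyy') hz) (mul_le_mul_of_nonneg_right hyy' hz.le)) hz.le

theorem norm_mul_comp (h : IsDemand U g s) (hZ : IsPriceDensity Q Z) {y : ℝ} (hy : 0 < y)
    (ω : Ω) : ‖Z ω * g (y * Z ω)‖ = Z ω * g (y * Z ω) :=
  Real.norm_of_nonneg (mul_nonneg (hZ.pos ω).le (h.nonneg _ (mul_pos hy (hZ.pos ω))))

/-- Dominated convergence: near `y` the integrand is bounded by its value at `y / 2`, by
monotonicity, and `y * Z` almost surely avoids the countably many jumps of `g`. -/
theorem continuousOn_budget (h : IsDemand U g s) (hZ : IsPriceDensity Q Z) :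
    ContinuousOn (fun y => ∫ ω, Z ω * g (y * Z ω) ∂Q) (Set.Ioi 0) := by
  intro y hy
  have hy : 0 < y := hy
  refine (continuousAt_of_dominated (bound := fun ω => Z ω * g (y / 2 * Z ω))
    (Eventually.of_forall fun y' =>
      (hZ.measurable.mul (h.measurable_comp hZ y')).aestronglyMeasurable) ?_
    (h.integrable_mul_comp hZ (half_pos hy)) ?_).continuousWithinAt
  · filter_upwards [Ioi_mem_nhds (half_lt_self hy)] with y' hy'
    have h0 : 0 < y' := (half_pos hy).trans hy'
    refine ae_of_all _ fun ω => (h.norm_mul_comp hZ h0 ω).trans_le ?_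
    exact h.comp_le hZ (half_pos hy) (le_of_lt hy') ω
  · filter_upwards [hZ.ae_continuousAt h hy] with ω hω
    have h1 : ContinuousAt (fun y' => y' * Z ω) y := by fun_prop
    exact continuousAt_const.mul (ContinuousAt.comp (f := fun y' => y' * Z ω) hω h1)

/-- The demand `g` itself may be constant on intervals, so strictness comes from the threshold: on
the non-null event `s / y' < Z < s / y` demand is zero for `y'` and positive for `y`. -/
theorem strictAntiOn_budget (h : IsDemand U g s) (hZ : IsPriceDensity Q Z) :
    StrictAntiOn (fun y => ∫ ω, Z ω * g (y * Z ω) ∂Q) (Set.Ioi 0) := by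
  intro y hy y' hy' hlt
  have hy : 0 < y := hy
  have hy' : 0 < y' := hy'
  have hle : ∀ ω, Z ω * g (y' * Z ω) ≤ Z ω * g (y * Z ω) := h.comp_le hZ hy hlt.le
  have i1 := h.integrable_mul_comp hZ hy
  have i2 := h.integrable_mul_comp hZ hy'
  refine sub_pos.1 ?_
  simp only
  rw [← integral_sub i1 i2, integral_pos_iff_support_of_nonneg (fun ω => sub_nonneg.2 (hle ω))
    (i1.sub i2)]
  have hpos := hZ.charges (s / y') (s / y) (div_lt_div_of_pos_left h.threshold_pos hy hlt)
    (div_pos h.threshold_pos hy)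
  refine hpos.trans_le (measure_mono ?_)
  rintro ω ⟨h1, h2⟩
  have hz := hZ.pos ω
  rw [div_lt_iff₀ hy'] at h1
  rw [lt_div_iff₀ hy] at h2
  have e1 : g (y' * Z ω) = 0 := h.zero _ (by linarith)
  have e2 : 0 < g (y * Z ω) := h.pos _ (mul_pos hy hz) (by linarith)
  simp only [Function.mem_support, e1, mul_zero, sub_zero]
  exact (mul_pos hz e2).ne'

theorem exists_le_budget (h : IsDemand U g s) (hZ : IsPriceDensity Q Z) (w : ℝ) :
    ∃ y, 0 < y ∧ w ≤ ∫ ω, Z ω * g (y * Z ω) ∂Q := by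
  -- On this event `x * Z ≤ x`, so demand is at least `g x`; choosing `x` with `g x ≥ K` makes its
  -- cost there at least `|w|`.
  set S : Set Ω := {ω | 0 < Z ω ∧ Z ω < 1} with hS
  have hSm : MeasurableSet S :=
    (measurableSet_lt measurable_const hZ.measurable).inter
      (measurableSet_lt hZ.measurable measurable_const)
  have hI : 0 < ∫ ω in S, Z ω ∂Q := by
    rw [setIntegral_pos_iff_support_of_nonneg_ae (ae_of_all _ fun ω => (hZ.pos ω).le)
      hZ.integrable.integrableOn]
    refine (hZ.charges 0 1 one_pos one_pos).trans_le (measure_mono ?_)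
    exact fun ω hω => ⟨(hZ.pos ω).ne', hω⟩
  set K := |w| / ∫ ω in S, Z ω ∂Q with hK
  have hK0 : 0 ≤ K := by positivity
  obtain ⟨x, hx, hgx⟩ : ∃ x, 0 < x ∧ K ≤ g x := by
    have := (h.explodes.eventually_ge_atTop K).and self_mem_nhdsWithin
    obtain ⟨x, h1, h2⟩ := this.exists
    exact ⟨x, h2, h1⟩
  refine ⟨x, hx, ?_⟩
  calc w ≤ |w| := le_abs_self w
    _ = ∫ ω in S, K * Z ω ∂Q := by
        rw [integral_const_mul, hK, div_mul_cancel₀ _ hI.ne']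
    _ ≤ ∫ ω in S, Z ω * g (x * Z ω) ∂Q := by
        refine setIntegral_mono_on (hZ.integrable.const_mul K).integrableOn
          (h.integrable_mul_comp hZ hx).integrableOn hSm fun ω hω => ?_
        have hz := hZ.pos ω
        have : g x ≤ g (x * Z ω) := h.antitoneOn (mul_pos hx hz) hx
          (by nlinarith [hω.2])
        nlinarith [hgx.trans this]
    _ ≤ ∫ ω, Z ω * g (x * Z ω) ∂Q :=
        setIntegral_le_integral (h.integrable_mul_comp hZ hx)
          (ae_of_all _ fun ω => mul_nonneg (hZ.pos ω).le (h.nonneg _ (mul_pos hx (hZ.pos ω))))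

theorem exists_budget_le (h : IsDemand U g s) (hZ : IsPriceDensity Q Z) {w : ℝ} (hw : 0 < w) :
    ∃ y, 0 < y ∧ ∫ ω, Z ω * g (y * Z ω) ∂Q ≤ w := by
  have ht : Tendsto (fun y => ∫ ω, Z ω * g (y * Z ω) ∂Q) atTop (𝓝 (∫ _, (0 : ℝ) ∂Q)) := by
    refine tendsto_integral_filter_of_dominated_convergence (fun ω => Z ω * g (1 * Z ω))
      (Eventually.of_forall fun y' =>
        (hZ.measurable.mul (h.measurable_comp hZ y')).aestronglyMeasurable) ?_
      (h.integrable_mul_comp hZ one_pos) (ae_of_all _ fun ω => ?_)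
    · filter_upwards [eventually_ge_atTop 1] with y hy
      refine ae_of_all _ fun ω => (h.norm_mul_comp hZ (one_pos.trans_le hy) ω).trans_le ?_
      exact h.comp_le hZ one_pos hy ω
    -- For each `ω` the integrand is eventually zero, once `y * Z ω` exceeds the threshold.
    · refine tendsto_const_nhds.congr' ?_
      filter_upwards [eventually_gt_atTop (s / Z ω)] with y hy
      rw [div_lt_iff₀ (hZ.pos ω)] at hy
      rw [h.zero _ hy, mul_zero]
  rw [integral_zero] at ht
  obtain ⟨y, h1, h2⟩ := ((ht.eventually_le_const hw).and (eventually_gt_atTop 0)).exists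
  exact ⟨y, h2, h1⟩

theorem existsUnique_budget_eq (h : IsDemand U g s) (hZ : IsPriceDensity Q Z) {w : ℝ}
    (hw : 0 < w) : ∃! y, 0 < y ∧ ∫ ω, Z ω * g (y * Z ω) ∂Q = w := by
  obtain ⟨y₁, hy₁, h₁⟩ := h.exists_le_budget hZ w
  obtain ⟨y₂, hy₂, h₂⟩ := h.exists_budget_le hZ hw
  obtain ⟨y, hy, he⟩ := isPreconnected_Ioi.intermediate_value hy₂ hy₁
    (h.continuousOn_budget hZ) ⟨h₂, h₁⟩
  exact ⟨y, ⟨hy, he⟩, fun y' hy' => (h.strictAntiOn_budget hZ).injOn hy'.1 hy (hy'.2.trans he.symm)⟩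

/-- Utilities lie below an affine function. -/
theorem utility_le (h : IsDemand U g s) {x v : ℝ} (hx : 0 < x) (hv : 0 ≤ v) :
    U v ≤ U (g x) - x * g x + x * v := by
  linarith [h.isMax x hx v hv]

/-- Utility is bounded below by `U 0`, so an integrable upper bound is enough. Hence all extended
expectations in the optimization are ordinary integrals. -/
theorem integrable_utility_of_integrable [IsFiniteMeasure Q] (h : IsDemand U g s) {V R : Ω → ℝ} (hm : Measurable V)
    (hV : ∀ᵐ ω ∂Q, 0 ≤ V ω) (hR : Integrable R Q) (hle : ∀ᵐ ω ∂Q, U (V ω) ≤ R ω) :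
    Integrable (fun ω => U (V ω)) Q := by
  refine ((hR.norm).add (integrable_const |U 0|)).mono'
    (h.measurable_utility.comp hm).aestronglyMeasurable ?_
  filter_upwards [hV, hle] with ω h0 h1
  have h2 := h.utility_zero_le _ h0
  simp only [Pi.add_apply, Real.norm_eq_abs]
  rw [abs_le]
  constructor
  · linarith [neg_abs_le (U 0), abs_nonneg (R ω)]
  · linarith [le_abs_self (R ω), abs_nonneg (U 0)]

theorem integrable_utility_comp [IsFiniteMeasure Q] (h : IsDemand U g s) (hZ : IsPriceDensity Q Z) {y : ℝ}
    (hy : 0 < y) : Integrable (fun ω => U (g (y * Z ω))) Q := by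
  have hg : ∀ ω, 0 ≤ g (y * Z ω) := fun ω => h.nonneg _ (mul_pos hy (hZ.pos ω))
  refine h.integrable_utility_of_integrable (h.measurable_comp hZ y) (ae_of_all _ hg)
    (R := fun ω => U (g 1) - 1 * g 1 + 1 * g (y * Z ω))
    ((integrable_const _).add ((h.integrable_comp hZ hy).const_mul 1))
    (ae_of_all _ fun ω => h.utility_le one_pos (hg ω))

end IsDemand

theorem extExpectation_eq_integral {Ω : Type*} [MeasurableSpace Ω] {Q : Measure Ω} {f : Ω → ℝ}
    (hf : Integrable f Q) : extExpectation Q f = ((∫ ω, f ω ∂Q : ℝ) : EReal) := by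
  rw [integral_eq_lintegral_pos_part_sub_lintegral_neg_part hf, extExpectation, EReal.coe_sub,
    EReal.coe_ennreal_toReal, EReal.coe_ennreal_toReal]
  · simpa [ofReal_norm] using (hf.neg.lintegral_lt_top).ne
  · exact hf.lintegral_lt_top.ne

/-! ### Optimality and almost sure uniqueness by duality -/

namespace Model

variable {Ω : Type*} [mΩ : MeasurableSpace Ω] {Q : Measure Ω} {p : Model}
  {ℱ : Filtration ℝ≥0 mΩ} {W : ℝ≥0 → Ω → ℝ} {V : Ω → ℝ}

theorem IsFeasible.measurable' (hV : p.IsFeasible ℱ Q W V) : Measurable V :=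
  hV.measurable.mono (ℱ.le _) le_rfl

theorem IsFeasible.mul_nonneg (hV : p.IsFeasible ℱ Q W V) :
    0 ≤ᵐ[Q] fun ω => p.Z W p.T ω * V ω := by
  filter_upwards [hV.nonneg] with ω h
  exact _root_.mul_nonneg (Real.exp_pos _).le h

theorem IsFeasible.integrable (hV : p.IsFeasible ℱ Q W V)
    (hZ : IsPriceDensity Q (p.Z W p.T)) : Integrable (fun ω => p.Z W p.T ω * V ω) Q := by
  refine ⟨(hZ.measurable.mul hV.measurable').aestronglyMeasurable, ?_⟩
  rw [hasFiniteIntegral_iff_ofReal hV.mul_nonneg]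
  exact hV.budget.trans_lt ENNReal.ofReal_lt_top

theorem IsFeasible.integral_le (hV : p.IsFeasible ℱ Q W V)
    (hZ : IsPriceDensity Q (p.Z W p.T)) (hv : 0 < p.v₀) :
    ∫ ω, p.Z W p.T ω * V ω ∂Q ≤ p.v₀ := by
  rw [integral_eq_lintegral_of_nonneg_ae hV.mul_nonneg (hV.integrable hZ).aestronglyMeasurable]
  exact ENNReal.toReal_le_of_le_ofReal hv.le hV.budget

variable {g : ℝ → ℝ} {s y : ℝ}

theorem isFeasible_demand (h : IsDemand p.UM g s) (hZ : IsPriceDensity Q (p.Z W p.T))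
    (hm : Measurable[ℱ p.T] (p.Z W p.T)) (hy : 0 < y)
    (hb : ∫ ω, p.Z W p.T ω * g (y * p.Z W p.T ω) ∂Q = p.v₀) :
    p.IsFeasible ℱ Q W (fun ω => g (y * p.Z W p.T ω)) where
  measurable := h.measurable.comp (hm.const_mul y)
  nonneg := ae_of_all _ fun ω => h.nonneg _ (mul_pos hy (hZ.pos ω))
  budget := by
    rw [← hb, ofReal_integral_eq_lintegral_ofReal (h.integrable_mul_comp hZ hy)]
    exact ae_of_all _ fun ω =>
      _root_.mul_nonneg (hZ.pos ω).le (h.nonneg _ (mul_pos hy (hZ.pos ω)))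

theorem IsFeasible.integrable_bound [IsFiniteMeasure Q] (hV : p.IsFeasible ℱ Q W V) (h : IsDemand p.UM g s)
    (hZ : IsPriceDensity Q (p.Z W p.T)) (hy : 0 < y) :
    Integrable (fun ω => p.UM (g (y * p.Z W p.T ω))
      - y * (p.Z W p.T ω * g (y * p.Z W p.T ω)) + y * (p.Z W p.T ω * V ω)) Q :=
  ((h.integrable_utility_comp hZ hy).sub ((h.integrable_mul_comp hZ hy).const_mul y)).add
    ((hV.integrable hZ).const_mul y)

theorem IsFeasible.utility_le (hV : p.IsFeasible ℱ Q W V) (h : IsDemand p.UM g s)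
    (hZ : IsPriceDensity Q (p.Z W p.T)) (hy : 0 < y) :
    ∀ᵐ ω ∂Q, p.UM (V ω) ≤ p.UM (g (y * p.Z W p.T ω))
      - y * (p.Z W p.T ω * g (y * p.Z W p.T ω)) + y * (p.Z W p.T ω * V ω) := by
  filter_upwards [hV.nonneg] with ω h0
  have := h.utility_le (mul_pos hy (hZ.pos ω)) h0
  linarith

theorem IsFeasible.integrable_utility [IsFiniteMeasure Q] (hV : p.IsFeasible ℱ Q W V) (h : IsDemand p.UM g s)
    (hZ : IsPriceDensity Q (p.Z W p.T)) (hy : 0 < y) : Integrable (fun ω => p.UM (V ω)) Q :=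
  h.integrable_utility_of_integrable hV.measurable' hV.nonneg
    (hV.integrable_bound h hZ hy) (hV.utility_le h hZ hy)

/-- Weak duality: the demand spends exactly `v₀` and `V` at most `v₀`, so the two price terms
contribute at most zero. -/
theorem IsFeasible.integral_bound_le [IsFiniteMeasure Q] (hV : p.IsFeasible ℱ Q W V) (h : IsDemand p.UM g s)
    (hZ : IsPriceDensity Q (p.Z W p.T)) (hv : 0 < p.v₀) (hy : 0 < y)
    (hb : ∫ ω, p.Z W p.T ω * g (y * p.Z W p.T ω) ∂Q = p.v₀) :
    ∫ ω, (p.UM (g (y * p.Z W p.T ω))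
      - y * (p.Z W p.T ω * g (y * p.Z W p.T ω)) + y * (p.Z W p.T ω * V ω)) ∂Q
      ≤ ∫ ω, p.UM (g (y * p.Z W p.T ω)) ∂Q := by
  have i1 := h.integrable_utility_comp hZ hy
  have i2 := (h.integrable_mul_comp hZ hy).const_mul y
  have i3 := (hV.integrable hZ).const_mul y
  rw [integral_add (by exact i1.sub i2) i3, integral_sub i1 i2, integral_const_mul, integral_const_mul, hb]
  nlinarith [hV.integral_le hZ hv]

theorem isOptimal_demand [IsFiniteMeasure Q] (h : IsDemand p.UM g s) (hZ : IsPriceDensity Q (p.Z W p.T))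
    (hm : Measurable[ℱ p.T] (p.Z W p.T)) (hv : 0 < p.v₀) (hy : 0 < y)
    (hb : ∫ ω, p.Z W p.T ω * g (y * p.Z W p.T ω) ∂Q = p.v₀) :
    p.IsOptimal ℱ Q W (fun ω => g (y * p.Z W p.T ω)) := by
  refine ⟨isFeasible_demand h hZ hm hy hb, fun V hV => ?_⟩
  rw [extExpectation_eq_integral (hV.integrable_utility h hZ hy),
    extExpectation_eq_integral (h.integrable_utility_comp hZ hy), EReal.coe_le_coe_iff]
  exact (integral_mono_ae (hV.integrable_utility h hZ hy) (hV.integrable_bound h hZ hy)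
    (hV.utility_le h hZ hy)).trans (hV.integral_bound_le h hZ hv hy hb)

theorem IsOptimal.ae_eq_demand [IsFiniteMeasure Q] (hV : p.IsOptimal ℱ Q W V) (h : IsDemand p.UM g s)
    (hZ : IsPriceDensity Q (p.Z W p.T)) (hm : Measurable[ℱ p.T] (p.Z W p.T)) (hv : 0 < p.v₀)
    (hy : 0 < y) (hb : ∫ ω, p.Z W p.T ω * g (y * p.Z W p.T ω) ∂Q = p.v₀) :
    ∀ᵐ ω ∂Q, V ω = g (y * p.Z W p.T ω) := by
  have h1 := hV.2 _ (isFeasible_demand h hZ hm hy hb)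
  rw [extExpectation_eq_integral (hV.1.integrable_utility h hZ hy),
    extExpectation_eq_integral (h.integrable_utility_comp hZ hy), EReal.coe_le_coe_iff] at h1
  -- Optimality of `V` closes the chain of integral inequalities, so the pointwise Lagrangian bound
  -- is an equality almost everywhere. Thus `V ω` maximizes at the price `y * Z ω`, where the
  -- maximizer is almost surely unique.
  have h2 := (integral_eq_iff_of_ae_le (hV.1.integrable_utility h hZ hy)
    (hV.1.integrable_bound h hZ hy) (hV.1.utility_le h hZ hy)).1
    (le_antisymm (integral_mono_ae (hV.1.integrable_utility h hZ hy)
      (hV.1.integrable_bound h hZ hy) (hV.1.utility_le h hZ hy))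
      ((hV.1.integral_bound_le h hZ hv hy hb).trans h1))
  filter_upwards [h2, hV.1.nonneg, hZ.ae_continuousAt h hy] with ω e h0 hc
  refine h.eq_of_isMax (mul_pos hy (hZ.pos ω)) hc h0 ?_
  linarith

end Model

end FirstLoss

/-! ### The log-normal law of the state price density -/

namespace FirstLoss

section LogNormal

variable {Ω : Type*} [MeasurableSpace Ω] {Q : Measure Ω} {N : Ω → ℝ}

theorem isPriceDensity_exp (hN : Measurable N) (hlaw : Q.map N = gaussianReal 0 1) (a : ℝ)
    {τ : ℝ} (hτ : 0 < τ) : IsPriceDensity Q (fun ω => Real.exp (a - τ * N ω)) where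
  measurable := by fun_prop
  pos ω := Real.exp_pos _
  noAtom x := by
    have := nullSingletonClass_gaussianReal (μ := 0) (v := 1) one_ne_zero
    have h0 : Q (N ⁻¹' {(a - Real.log x) / τ}) = 0 := by
      rw [← Measure.map_apply hN (measurableSet_singleton _), hlaw, measure_singleton]
    refine measure_mono_null ?_ h0
    rintro ω rfl
    simp only [Set.mem_preimage, Set.mem_singleton_iff, Real.log_exp]
    field_simp
    ring
  moment e := by
    have h1 : Integrable (fun x => Real.exp (-e * τ * x)) (Q.map N) := by
      rw [hlaw]
      exact integrable_exp_mul_gaussianReal _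
    refine ((h1.comp_measurable hN).const_mul (Real.exp (a * e))).congr
      (Filter.Eventually.of_forall fun ω => ?_)
    simp only [Function.comp_apply]
    rw [← Real.exp_add, ← Real.exp_mul]
    congr 1
    ring
  charges s t hst ht := by
    -- The left endpoint may be nonpositive; it is raised to a positive number below `t` so that its
    -- logarithm can be used.
    set s' := max s (t / 2) with hs'
    have hs0 : 0 < s' := (half_pos ht).trans_le (le_max_right _ _)
    have hlt : s' < t := max_lt hst (half_lt_self ht)
    have h1 : 0 < Q (N ⁻¹' Set.Ioo ((a - Real.log t) / τ) ((a - Real.log s') / τ)) := by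
      rw [← Measure.map_apply hN measurableSet_Ioo, hlaw, pos_iff_ne_zero]
      intro h0
      have := gaussianReal_absolutelyContinuous' 0 one_ne_zero h0
      rw [Real.volume_Ioo, ENNReal.ofReal_eq_zero, sub_nonpos,
        div_le_div_iff_of_pos_right hτ] at this
      linarith [Real.log_lt_log hs0 hlt]
    refine h1.trans_le (measure_mono ?_)
    rintro ω ⟨h2, h3⟩
    rw [div_lt_iff₀ hτ] at h2
    rw [lt_div_iff₀ hτ] at h3
    constructor
    · refine (le_max_left s (t / 2)).trans_lt ?_
      rw [← hs', ← Real.log_lt_iff_lt_exp hs0]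
      linarith
    · rw [← Real.lt_log_iff_exp_lt ht]
      linarith

theorem measureReal_lt_exp [IsProbabilityMeasure Q] (hN : Measurable N)
    (hlaw : Q.map N = gaussianReal 0 1) (a : ℝ) {τ x : ℝ} (hτ : 0 < τ) (hx : 0 < x) :
    Q.real {ω | x < Real.exp (a - τ * N ω)} = Phi ((a - Real.log x) / τ) := by
  have := nullSingletonClass_gaussianReal (μ := 0) (v := 1) one_ne_zero
  rw [Phi, cdf_eq_real, ← measureReal_congr (Iio_ae_eq_Iic (μ := gaussianReal 0 1)), ← hlaw,
    map_measureReal_apply hN measurableSet_Iio]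
  congr 1
  ext ω
  simp only [Set.mem_ofPred_eq, Set.mem_preimage, Set.mem_Iio]
  rw [← Real.log_lt_iff_lt_exp hx, lt_div_iff₀ hτ]
  constructor <;> intro h <;> linarith

end LogNormal

namespace Model

variable {Ω : Type*} [mΩ : MeasurableSpace Ω] {Q : Measure Ω} {p : Model}
  {ℱ : Filtration ℝ≥0 mΩ} {W : ℝ≥0 → Ω → ℝ}

theorem Admissible.γ_ne (hp : p.Admissible) : p.γ ≠ 0 :=
  mul_ne_zero (inv_ne_zero hp.σ_pos.ne') (sub_ne_zero.2 hp.μ_ne)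

theorem Admissible.volatility_pos (hp : p.Admissible) : 0 < |p.γ| * Real.sqrt p.T :=
  mul_pos (abs_pos.2 hp.γ_ne) (Real.sqrt_pos.2 (by exact_mod_cast hp.T_pos))

theorem Admissible.map_normalized (hp : p.Admissible) (hW : IsWienerOn p.T ℱ Q W) :
    Q.map (fun ω => p.γ / (|p.γ| * Real.sqrt p.T) * W p.T ω) = gaussianReal 0 1 := by
  have hm : Measurable (W p.T) := (hW.adapted _ le_rfl).mono (ℱ.le _) le_rfl
  have h1 : Q.map (W p.T) = gaussianReal 0 p.T := by
    have := hW.law_increment 0 p.T zero_le le_rfl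
    rw [tsub_zero] at this
    rw [← this]
    refine Measure.map_congr ?_
    filter_upwards [hW.zero] with ω hω
    rw [hω, sub_zero]
  have h2 := Measure.map_map (μ := Q)
    (measurable_const_mul (p.γ / (|p.γ| * Real.sqrt p.T))) hm
  rw [h1, gaussianReal_map_const_mul] at h2
  refine (h2.symm.trans ?_)
  rw [mul_zero]
  congr 1
  have hT : (0 : ℝ) < p.T := by exact_mod_cast hp.T_pos
  have := hp.γ_ne
  ext
  change (p.γ / (|p.γ| * Real.sqrt p.T)) ^ 2 * (p.T : ℝ) = 1
  rw [div_pow, mul_pow, sq_abs, Real.sq_sqrt hT.le]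
  field_simp

/-- The sign of `γ` is moved into the standard normal variable, so that the volatility `|γ| √T` is
positive and the lemmas on `exp (a - τ N)` apply. -/
theorem Admissible.Z_eq {Ω : Type*} {W : ℝ≥0 → Ω → ℝ} (hp : p.Admissible) (ω : Ω) :
    p.Z W p.T ω = Real.exp (-(p.r + 1 / 2 * p.γ ^ 2) * p.T - |p.γ| * Real.sqrt p.T *
      (p.γ / (|p.γ| * Real.sqrt p.T) * W p.T ω)) := by
  rw [Z, ← mul_assoc, mul_div_cancel₀ _ hp.volatility_pos.ne']

theorem measurable_Z_of_isWienerOn (hW : IsWienerOn p.T ℱ Q W) :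
    Measurable[ℱ p.T] (p.Z W p.T) :=
  Real.measurable_exp.comp (((hW.adapted _ le_rfl).const_mul p.γ).const_sub _)

theorem Admissible.isPriceDensity (hp : p.Admissible) (hW : IsWienerOn p.T ℱ Q W) :
    IsPriceDensity Q (p.Z W p.T) := by
  have hm : Measurable (W p.T) := (hW.adapted _ le_rfl).mono (ℱ.le _) le_rfl
  rw [funext (hp.Z_eq (W := W))]
  exact isPriceDensity_exp (hm.const_mul _) (hp.map_normalized hW) _ hp.volatility_pos

theorem Admissible.measureReal_lt_Z [IsProbabilityMeasure Q] (hp : p.Admissible)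
    (hW : IsWienerOn p.T ℱ Q W) {x y : ℝ} (hx : 0 < x) (hy : 0 < y) :
    Q.real {ω | x < y * p.Z W p.T ω} = Phi (p.d y x) := by
  have hm : Measurable (W p.T) := (hW.adapted _ le_rfl).mono (ℱ.le _) le_rfl
  have h1 := measureReal_lt_exp (hm.const_mul _) (hp.map_normalized hW)
    (-(p.r + 1 / 2 * p.γ ^ 2) * p.T) hp.volatility_pos (div_pos hx hy)
  rw [d, Real.log_div hy.ne' hx.ne']
  rw [Real.log_div hx.ne' hy.ne'] at h1
  convert h1 using 3
  · ext ω
    rw [← hp.Z_eq, div_lt_iff₀' hy]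
  · ring

end Model

end FirstLoss

/-! ### Tangency equations: existence and uniqueness of `θ` -/

namespace FirstLoss

/-- `x ^ (1 - b) / (1 - b) - (x + K) x ^ (-b)`: the intercept at `-K` of the tangent at `x` to the
graph of the power utility function with risk aversion `b`. -/
noncomputable def tangentIntercept (b K x : ℝ) : ℝ := b / (1 - b) * x ^ (1 - b) - K * x ^ (-b)

theorem tangentIntercept_eq {b K x : ℝ} (hb : b ≠ 1) (hx : 0 < x) :
    tangentIntercept b K x = x ^ (1 - b) / (1 - b) - (x + K) * x ^ (-b) := by
  have h1 : 1 - b ≠ 0 := sub_ne_zero.2 hb.symm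
  have h2 : x * x ^ (-b) = x ^ (1 - b) := by
    rw [← Real.rpow_one_add' hx.le (by simpa [sub_eq_add_neg] using h1), sub_eq_add_neg]
  rw [tangentIntercept, add_mul, h2]
  field_simp
  ring

theorem tangentIntercept_eq_iff {b K x t : ℝ} (hb : b ≠ 1) (hx : 0 < x) :
    tangentIntercept b K x = t / (1 - b) ↔ x ^ (-b) * (b * (x + K) - K) = t := by
  have h1 : 1 - b ≠ 0 := sub_ne_zero.2 hb.symm
  have h2 : x * x ^ (-b) = x ^ (1 - b) := by
    rw [← Real.rpow_one_add' hx.le (by simpa [sub_eq_add_neg] using h1), sub_eq_add_neg]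
  rw [eq_div_iff h1, tangentIntercept, ← h2]
  have : (b / (1 - b) * (x * x ^ (-b)) - K * x ^ (-b)) * (1 - b)
      = x ^ (-b) * (b * (x + K) - K) := by
    field_simp
    ring
  rw [this]

theorem hasDerivAt_tangentIntercept {b K x : ℝ} (hb : b ≠ 1) (hx : 0 < x) :
    HasDerivAt (tangentIntercept b K) (b * x ^ (-b - 1) * (x + K)) x := by
  have h1 : 1 - b ≠ 0 := sub_ne_zero.2 hb.symm
  have h := ((Real.hasDerivAt_rpow_const (p := 1 - b) (Or.inl hx.ne')).const_mul
    (b / (1 - b))).sub ((Real.hasDerivAt_rpow_const (p := -b) (Or.inl hx.ne')).const_mul K)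
  refine h.congr_deriv ?_
  rw [show 1 - b - 1 = (-b - 1) + 1 by ring, Real.rpow_add_one hx.ne']
  field_simp
  ring

theorem continuousOn_tangentIntercept {b K : ℝ} (hb : b ≠ 1) :
    ContinuousOn (tangentIntercept b K) (Set.Ioi 0) :=
  fun _ hx => (hasDerivAt_tangentIntercept hb hx).continuousAt.continuousWithinAt

/-- The derivative `b * x ^ (-b - 1) * (x + K)` is positive to the right of `-K`. This gives
uniqueness of `θ`. -/
theorem strictMonoOn_tangentIntercept {a b K : ℝ} (hb0 : 0 < b) (hb : b ≠ 1) (ha : 0 ≤ a)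
    (haK : 0 ≤ a + K) : StrictMonoOn (tangentIntercept b K) (Set.Ioi a) := by
  refine strictMonoOn_of_deriv_pos (convex_Ioi a)
    ((continuousOn_tangentIntercept hb).mono (Set.Ioi_subset_Ioi ha)) fun x hx => ?_
  rw [interior_Ioi] at hx
  have hx : a < x := hx
  have hx0 : 0 < x := ha.trans_lt hx
  rw [(hasDerivAt_tangentIntercept hb hx0).deriv]
  have := Real.rpow_pos_of_pos hx0 (-b - 1)
  have : 0 < x + K := by linarith
  positivity

theorem exists_tangentIntercept_eq {a b K X t : ℝ} (hb0 : 0 < b) (hb : b ≠ 1) (ha : 0 ≤ a)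
    (haK : 0 < a + K) (haX : a < X) (hpos : 0 < a → tangentIntercept b K a < t)
    (hzero : a = 0 → b < 1 ∧ t = 0) (hX : t < tangentIntercept b K X) :
    ∃ x, a < x ∧ x < X ∧ tangentIntercept b K x = t := by
  -- At `a = 0` the intercept is not continuous from the right because of `x ^ (-b)`, so the
  -- intermediate value theorem is replaced by the explicit zero `(1 - b) * K / b`.
  rcases ha.eq_or_lt with rfl | ha
  · obtain ⟨hb1, rfl⟩ := hzero rfl
    have hK : 0 < K := by linarith
    have h1b : 0 < 1 - b := by linarith
    have hx : 0 < (1 - b) * K / b := by positivity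
    have he : tangentIntercept b K ((1 - b) * K / b) = 0 := by
      rw [← zero_div (1 - b), tangentIntercept_eq_iff hb hx]
      have : b * ((1 - b) * K / b + K) - K = 0 := by
        field_simp
        ring
      rw [this, mul_zero]
    refine ⟨_, hx, ?_, he⟩
    rwa [← he, (strictMonoOn_tangentIntercept hb0 hb le_rfl haK.le).lt_iff_lt hx haX] at hX
  · obtain ⟨x, hx, he⟩ := intermediate_value_Ioo haX.le
      ((continuousOn_tangentIntercept hb).mono fun y hy => ha.trans_le hy.1)
      ⟨hpos ha, hX⟩
    exact ⟨x, hx.1, hx.2, he⟩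

/-- At infinity the intercept tends to `+∞` if `b < 1` and to `0` if `b > 1`; in the latter case the
target is negative. -/
theorem exists_lt_tangentIntercept {b K t : ℝ} (hb0 : 0 < b) (hb : b ≠ 1)
    (ht : 1 < b → t < 0) (a : ℝ) : ∃ x, a < x ∧ t < tangentIntercept b K x := by
  have h0 := (tendsto_rpow_neg_atTop hb0).const_mul K
  rw [mul_zero] at h0
  have hev : ∀ᶠ x in Filter.atTop, t < tangentIntercept b K x := by
    rcases hb.lt_or_gt with hb1 | hb1
    · have h1 : Filter.Tendsto (fun x : ℝ => b / (1 - b) * x ^ (1 - b)) Filter.atTop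
          Filter.atTop :=
        (tendsto_rpow_atTop (by linarith)).const_mul_atTop (div_pos hb0 (by linarith))
      have h2 : Filter.Tendsto (tangentIntercept b K) Filter.atTop Filter.atTop := by
        exact (h1.atTop_add h0.neg).congr fun x => (sub_eq_add_neg _ _).symm
      exact h2.eventually_gt_atTop t
    · have h1 := (tendsto_rpow_neg_atTop (y := b - 1) (by linarith)).const_mul (b / (1 - b))
      have h2 := h1.sub h0
      simp only [neg_sub, mul_zero, sub_zero] at h2
      exact h2.eventually_const_lt (ht hb1)
  exact ((Filter.eventually_gt_atTop a).and hev).exists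

namespace Model

variable {p : Model}

theorem Admissible.floor_nonneg (hp : p.Admissible) : 0 ≤ p.v₀ * (p.m - p.c) + p.aM := by
  rcases hp.bM_ne.lt_or_gt with h | h
  · linarith [hp.aM_of_lt h]
  · linarith [hp.aM_of_gt h]

theorem Admissible.floor_pos (hp : p.Admissible) (h : 1 < p.bM) :
    0 < p.v₀ * (p.m - p.c) + p.aM := by
  linarith [hp.aM_of_gt h]

theorem Admissible.floor_le_kink (hp : p.Admissible) :
    p.v₀ * (p.m - p.c) + p.aM ≤ p.m * p.v₀ + p.aM := by
  nlinarith [mul_nonneg hp.c_nonneg hp.v₀_pos.le]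

theorem Admissible.kink_nonneg (hp : p.Admissible) : 0 ≤ p.m * p.v₀ + p.aM :=
  hp.floor_nonneg.trans hp.floor_le_kink

theorem Admissible.level_pos (hp : p.Admissible) : 0 < (1 + p.m) * p.v₀ :=
  mul_pos (by linarith [hp.m_nonneg]) hp.v₀_pos

theorem Admissible.flat_pos (hp : p.Admissible) : 0 < (1 + p.m - p.c) * p.v₀ :=
  mul_pos (by linarith [hp.c_lt]) hp.v₀_pos

theorem Admissible.flat_le_level (hp : p.Admissible) :
    (1 + p.m - p.c) * p.v₀ ≤ (1 + p.m) * p.v₀ := by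
  nlinarith [mul_nonneg hp.c_nonneg hp.v₀_pos.le]

theorem Admissible.level_mul_H (hp : p.Admissible) : (1 + p.m) * p.v₀ * p.H =
    (p.m * p.v₀ + p.aM) ^ (1 - p.bM) / (1 - p.bM)
      - (p.v₀ * (p.m - p.c) + p.aM) ^ (1 - p.bM) / (1 - p.bM) := by
  have h1 : 1 - p.bM ≠ 0 := sub_ne_zero.2 hp.bM_ne.symm
  have h2 := hp.v₀_pos.ne'
  have h3 : 1 + p.m ≠ 0 := by linarith [hp.m_nonneg]
  rw [H]
  field_simp

theorem Admissible.floor_rpow_of_eq_zero (hp : p.Admissible)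
    (h : p.v₀ * (p.m - p.c) + p.aM = 0) : p.bM < 1 ∧
      (p.v₀ * (p.m - p.c) + p.aM) ^ (1 - p.bM) / (1 - p.bM) = 0 := by
  have hb : p.bM < 1 := by
    by_contra hc
    exact (hp.floor_pos (lt_of_le_of_ne (not_lt.1 hc) hp.bM_ne.symm)).ne' h
  rw [h, Real.zero_rpow (by linarith), zero_div]
  exact ⟨hb, rfl⟩

/-- In the manager's shifted wealth `X`, the affine branch above the kink extends to `X = -K` at `v
= 0`, with `K = α (1 + m) v₀ - (m v₀ + aM)`. The equation therefore says that the tangent at `θ`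
passes through `(0, UM 0)`. -/
theorem Admissible.isThetaA_iff (hp : p.Admissible) {θ : ℝ} : p.IsThetaA θ ↔
    p.m * p.v₀ + p.aM < p.α * θ + (p.m - p.α * (1 + p.m)) * p.v₀ + p.aM ∧
      tangentIntercept p.bM (p.α * ((1 + p.m) * p.v₀) - (p.m * p.v₀ + p.aM))
        (p.α * θ + (p.m - p.α * (1 + p.m)) * p.v₀ + p.aM) =
        (p.v₀ * (p.m - p.c) + p.aM) ^ (1 - p.bM) / (1 - p.bM) := by
  have h1 : (1 + p.m) * p.v₀ < θ ↔
      p.m * p.v₀ + p.aM < p.α * θ + (p.m - p.α * (1 + p.m)) * p.v₀ + p.aM := by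
    rw [← mul_lt_mul_iff_right₀ hp.α_pos]
    constructor <;> intro h <;> nlinarith
  rw [IsThetaA, h1]
  refine and_congr_right fun h => ?_
  rw [tangentIntercept_eq_iff hp.bM_ne (hp.kink_nonneg.trans_lt h)]
  ring_nf

/-- The same tangency condition on the branch of slope `1`, which extends to `aM - v₀` at `v = 0`;
hence `K = v₀ - aM`. -/
theorem Admissible.isThetaC_iff (hp : p.Admissible) {θ : ℝ} : p.IsThetaC θ ↔
    p.v₀ * (p.m - p.c) + p.aM < θ - p.v₀ + p.aM ∧ θ - p.v₀ + p.aM < p.m * p.v₀ + p.aM ∧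
      tangentIntercept p.bM (p.v₀ - p.aM) (θ - p.v₀ + p.aM) =
        (p.v₀ * (p.m - p.c) + p.aM) ^ (1 - p.bM) / (1 - p.bM) := by
  have h1 : (1 + p.m - p.c) * p.v₀ < θ ↔
      p.v₀ * (p.m - p.c) + p.aM < θ - p.v₀ + p.aM := by
    constructor <;> intro h <;> nlinarith
  have h2 : θ < (1 + p.m) * p.v₀ ↔ θ - p.v₀ + p.aM < p.m * p.v₀ + p.aM := by
    constructor <;> intro h <;> nlinarith
  rw [IsThetaC, h1, h2]
  refine and_congr_right fun h => and_congr_right fun _ => ?_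
  rw [tangentIntercept_eq_iff hp.bM_ne (hp.floor_nonneg.trans_lt h)]
  ring_nf

theorem Admissible.existsUnique_isThetaA (hp : p.Admissible) (hA : p.CaseA) :
    ∃! θ, p.IsThetaA θ := by
  have hα := hp.α_pos
  have hK : 0 < (p.m * p.v₀ + p.aM) +
      (p.α * ((1 + p.m) * p.v₀) - (p.m * p.v₀ + p.aM)) := by
    linarith [mul_pos hα hp.level_pos]
  obtain ⟨X, hX, hXt⟩ := exists_lt_tangentIntercept
    (K := p.α * ((1 + p.m) * p.v₀) - (p.m * p.v₀ + p.aM))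
    (t := (p.v₀ * (p.m - p.c) + p.aM) ^ (1 - p.bM) / (1 - p.bM)) hp.bM_pos hp.bM_ne
    (fun h => div_neg_of_pos_of_neg (Real.rpow_pos_of_pos (hp.floor_pos h) _) (by linarith))
    (p.m * p.v₀ + p.aM)
  -- At the kink the intercept is below the target precisely because the chord slope `H` is below
  -- the right-hand slope there. If the kink argument is zero, so is the floor, which forces `bM <
  -- 1` and target zero.
  obtain ⟨x, hx1, -, hx2⟩ := exists_tangentIntercept_eq hp.bM_pos hp.bM_ne hp.kink_nonneg hK hX
    (fun hpos => by
      have hlt := hA.resolve_left hpos.ne'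
      have := hp.level_mul_H
      have := mul_lt_mul_of_pos_left hlt hp.level_pos
      rw [tangentIntercept_eq hp.bM_ne hpos]
      linarith)
    (fun h => hp.floor_rpow_of_eq_zero
      (le_antisymm (h ▸ hp.floor_le_kink) hp.floor_nonneg)) hXt
  have hs : ∀ θ : ℝ, p.α * θ + (p.m - p.α * (1 + p.m)) * p.v₀ + p.aM = x ↔
      θ = (x - (p.m - p.α * (1 + p.m)) * p.v₀ - p.aM) / p.α := by
    intro θ
    rw [eq_div_iff hα.ne']
    constructor <;> intro h <;> linarith
  refine ⟨_, hp.isThetaA_iff.2 ?_, fun θ hθ => (hs θ).1 ?_⟩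
  · rw [(hs _).2 rfl]
    exact ⟨hx1, hx2⟩
  · obtain ⟨h1, h2⟩ := hp.isThetaA_iff.1 hθ
    exact (strictMonoOn_tangentIntercept hp.bM_pos hp.bM_ne hp.kink_nonneg hK.le).injOn h1 hx1
      (h2.trans hx2.symm)

theorem Admissible.existsUnique_isThetaC (hp : p.Admissible) (hC : p.CaseC) :
    ∃! θ, p.IsThetaC θ := by
  have hB : 0 < p.m * p.v₀ + p.aM := lt_of_le_of_ne hp.kink_nonneg hC.1.symm
  have hK : 0 < (p.v₀ * (p.m - p.c) + p.aM) + (p.v₀ - p.aM) := by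
    linarith [hp.flat_pos]
  have hH := hp.level_mul_H
  have hlt := mul_lt_mul_of_pos_left hC.2 hp.level_pos
  -- If floor and kink coincided, `H` would vanish, but in Case C it exceeds a positive number.
  have hAB : p.v₀ * (p.m - p.c) + p.aM < p.m * p.v₀ + p.aM := by
    refine lt_of_le_of_ne hp.floor_le_kink fun he => ?_
    rw [he, sub_self] at hH
    have := mul_pos hp.level_pos (Real.rpow_pos_of_pos hB (-p.bM))
    linarith
  obtain ⟨x, hx1, hx3, hx2⟩ := exists_tangentIntercept_eq hp.bM_pos hp.bM_ne hp.floor_nonneg hK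
    hAB
    (fun hpos => by
      rw [tangentIntercept_eq hp.bM_ne hpos]
      linarith [mul_pos hK (Real.rpow_pos_of_pos hpos (-p.bM))])
    hp.floor_rpow_of_eq_zero
    (by
      rw [tangentIntercept_eq hp.bM_ne hB]
      linarith)
  have hs : ∀ θ : ℝ, θ - p.v₀ + p.aM = x ↔ θ = x + p.v₀ - p.aM := by
    intro θ
    constructor <;> intro h <;> linarith
  refine ⟨_, hp.isThetaC_iff.2 ?_, fun θ hθ => (hs θ).1 ?_⟩
  · rw [(hs _).2 rfl]
    exact ⟨hx1, hx3, hx2⟩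
  · obtain ⟨h1, -, h2⟩ := hp.isThetaC_iff.1 hθ
    exact (strictMonoOn_tangentIntercept hp.bM_pos hp.bM_ne hp.floor_nonneg hK.le).injOn h1 hx1
      (h2.trans hx2.symm)

end Model

end FirstLoss

/-! ### The manager's utility and its demand functions -/

namespace FirstLoss

/-- Tangents to the power utility function lie above its graph. -/
theorem rpow_div_le_tangent {b x x₀ : ℝ} (hb0 : 0 < b) (hb : b ≠ 1) (hx : 0 ≤ x)
    (hx1 : 1 < b → 0 < x) (hx₀ : 0 < x₀) :
    x ^ (1 - b) / (1 - b) ≤ x₀ ^ (1 - b) / (1 - b) + x₀ ^ (-b) * (x - x₀) := by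
  -- Homogeneity reduces the claim to tangency at `1`. It is weighted AM-GM for `b < 1`, and for `b
  -- > 1` it follows from `exp u ≥ 1 + u` and `log t ≤ t - 1`.
  obtain ⟨t, rfl⟩ : ∃ t, x = t * x₀ := ⟨x / x₀, by field_simp⟩
  have ht : 0 ≤ t := nonneg_of_mul_nonneg_left hx hx₀
  have h2 : x₀ ^ (-b) * (t * x₀ - x₀) = x₀ ^ (1 - b) * (t - 1) := by
    rw [sub_eq_add_neg 1 b, Real.rpow_add hx₀, Real.rpow_one]
    ring
  rw [h2, Real.mul_rpow ht hx₀.le]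
  have hp := Real.rpow_pos_of_pos hx₀ (1 - b)
  suffices h : t ^ (1 - b) / (1 - b) ≤ 1 / (1 - b) + (t - 1) by
    have := mul_le_mul_of_nonneg_left h hp.le
    calc _ = x₀ ^ (1 - b) * (t ^ (1 - b) / (1 - b)) := by ring
      _ ≤ _ := this
      _ = _ := by ring
  rcases hb.lt_or_gt with hb1 | hb1
  · have h1b : 0 < 1 - b := by linarith
    have := Real.geom_mean_le_arith_mean2_weighted h1b.le hb0.le ht zero_le_one (by ring)
    rw [Real.one_rpow, mul_one] at this
    rw [div_add' _ _ _ h1b.ne', div_le_div_iff_of_pos_right h1b]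
    linarith
  · have h1b : 1 - b < 0 := by linarith
    have ht0 : 0 < t := pos_of_mul_pos_left (hx1 hb1) hx₀.le
    rw [div_add' _ _ _ h1b.ne, div_le_div_right_of_neg h1b, Real.rpow_def_of_pos ht0]
    have h3 := Real.add_one_le_exp (Real.log t * (1 - b))
    have h4 := mul_le_mul_of_nonpos_right (Real.log_le_sub_one_of_pos ht0) h1b.le
    linarith

theorem rpow_neg_inv_rpow_neg {b x : ℝ} (hb : 0 < b) (hx : 0 < x) :
    (x ^ (-1 / b)) ^ (-b) = x := by
  rw [← Real.rpow_mul hx.le, show -1 / b * -b = 1 by field_simp, Real.rpow_one]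

theorem rpow_neg_rpow_neg_inv {b x : ℝ} (hb : 0 < b) (hx : 0 < x) :
    (x ^ (-b)) ^ (-1 / b) = x := by
  rw [← Real.rpow_mul hx.le, show -b * (-1 / b) = 1 by field_simp, Real.rpow_one]

theorem le_rpow_neg_inv {b x X : ℝ} (hb : 0 < b) (hx : 0 < x) (hX : 0 < X)
    (h : x ≤ X ^ (-b)) : X ≤ x ^ (-1 / b) := by
  rw [← rpow_neg_rpow_neg_inv hb hX]
  exact Real.rpow_le_rpow_of_nonpos hx h (div_nonpos_of_nonpos_of_nonneg (by norm_num) hb.le)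

theorem rpow_neg_inv_le {b x X : ℝ} (hb : 0 < b) (hX : 0 < X)
    (h : X ^ (-b) ≤ x) : x ^ (-1 / b) ≤ X := by
  have := Real.rpow_le_rpow_of_nonpos (Real.rpow_pos_of_pos hX (-b)) h
    (div_nonpos_of_nonpos_of_nonneg (by norm_num) hb.le : -1 / b ≤ 0)
  rwa [rpow_neg_rpow_neg_inv hb hX] at this

namespace Model

variable {p : Model}

theorem payoffI_of_lt {v : ℝ} (h : v < (1 + p.m - p.c) * p.v₀) :
    p.payoffI v = v + p.v₀ * (p.c - p.m) := by
  rw [payoffI, if_pos (by linarith)]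

theorem payoffI_of_mem {v : ℝ} (h : (1 + p.m - p.c) * p.v₀ ≤ v) (h' : v < (1 + p.m) * p.v₀) :
    p.payoffI v = p.v₀ := by
  rw [payoffI, if_neg (by linarith), if_pos (by linarith)]

theorem Admissible.payoffI_of_le (hp : p.Admissible) {v : ℝ} (h : (1 + p.m) * p.v₀ ≤ v) :
    p.payoffI v = v - p.m * p.v₀ - p.α * (v - (1 + p.m) * p.v₀) := by
  have := hp.flat_le_level
  rw [payoffI, if_neg (by linarith), if_neg (by linarith)]

/-- The argument of the manager's power utility function. -/
noncomputable def arg (p : Model) (v : ℝ) : ℝ := p.payoffM v + p.aM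

theorem UM_eq (v : ℝ) : p.UM v = p.arg v ^ (1 - p.bM) / (1 - p.bM) := by
  rw [UM, hara, arg]
  ring

theorem arg_of_lt {v : ℝ} (h : v < (1 + p.m - p.c) * p.v₀) :
    p.arg v = p.v₀ * (p.m - p.c) + p.aM := by
  rw [arg, payoffM, payoffI_of_lt h]
  ring

theorem Admissible.arg_of_mem (hp : p.Admissible) {v : ℝ} (h : (1 + p.m - p.c) * p.v₀ ≤ v)
    (h' : v ≤ (1 + p.m) * p.v₀) : p.arg v = p.m * p.v₀ + p.aM + (v - (1 + p.m) * p.v₀) := by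
  rcases h'.lt_or_eq with h' | rfl
  · rw [arg, payoffM, payoffI_of_mem h h']
    ring
  · rw [arg, payoffM, hp.payoffI_of_le le_rfl]
    ring

theorem Admissible.arg_of_le (hp : p.Admissible) {v : ℝ} (h : (1 + p.m) * p.v₀ ≤ v) :
    p.arg v = p.m * p.v₀ + p.aM + p.α * (v - (1 + p.m) * p.v₀) := by
  rw [arg, payoffM, hp.payoffI_of_le h]
  ring

/-- Above the flat region `arg` is the minimum of two lines through the kink, of slopes `1` and `α ≤
1`. This bound and `arg_le_mul` are the resulting supergradient inequalities. -/
theorem Admissible.arg_le (hp : p.Admissible) {v : ℝ} (h : (1 + p.m - p.c) * p.v₀ ≤ v) :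
    p.arg v ≤ p.m * p.v₀ + p.aM + (v - (1 + p.m) * p.v₀) := by
  rcases le_total v ((1 + p.m) * p.v₀) with h' | h'
  · exact (hp.arg_of_mem h h').le
  · rw [hp.arg_of_le h']
    nlinarith [hp.α_le_one]

theorem Admissible.arg_le_mul (hp : p.Admissible) {v : ℝ} (h : (1 + p.m - p.c) * p.v₀ ≤ v) :
    p.arg v ≤ p.m * p.v₀ + p.aM + p.α * (v - (1 + p.m) * p.v₀) := by
  rcases le_total v ((1 + p.m) * p.v₀) with h' | h'
  · rw [hp.arg_of_mem h h']
    nlinarith [hp.α_le_one]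
  · exact (hp.arg_of_le h').le

theorem Admissible.floor_le_arg (hp : p.Admissible) (v : ℝ) :
    p.v₀ * (p.m - p.c) + p.aM ≤ p.arg v := by
  rcases lt_or_ge v ((1 + p.m - p.c) * p.v₀) with h | h
  · exact (arg_of_lt h).ge
  rcases le_total v ((1 + p.m) * p.v₀) with h' | h'
  · rw [hp.arg_of_mem h h']
    linarith
  · rw [hp.arg_of_le h']
    have := mul_nonneg hp.α_pos.le (sub_nonneg.2 h')
    linarith [hp.floor_le_kink]

theorem Admissible.UM_le_tangent (hp : p.Admissible) (v : ℝ) {x : ℝ} (hx : 0 < x) :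
    p.UM v ≤ x ^ (1 - p.bM) / (1 - p.bM) + x ^ (-p.bM) * (p.arg v - x) := by
  rw [UM_eq]
  exact rpow_div_le_tangent hp.bM_pos hp.bM_ne (hp.floor_nonneg.trans (hp.floor_le_arg v))
    (fun h => (hp.floor_pos h).trans_le (hp.floor_le_arg v)) hx

theorem Admissible.arg_zero (hp : p.Admissible) : p.arg 0 = p.v₀ * (p.m - p.c) + p.aM :=
  arg_of_lt hp.flat_pos

theorem Admissible.UM_zero (hp : p.Admissible) :
    p.UM 0 = (p.v₀ * (p.m - p.c) + p.aM) ^ (1 - p.bM) / (1 - p.bM) := by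
  rw [UM_eq, hp.arg_zero]

theorem Admissible.UM_of_lt (hp : p.Admissible) {v : ℝ} (h : v < (1 + p.m - p.c) * p.v₀) :
    p.UM v = p.UM 0 := by
  rw [hp.UM_zero, UM_eq, arg_of_lt h]

theorem Admissible.UM_zero_le (hp : p.Admissible) (v : ℝ) : p.UM 0 ≤ p.UM v := by
  have h := hp.floor_le_arg v
  rcases (hp.floor_nonneg.trans h).eq_or_lt with h0 | h0
  · rw [UM_eq, UM_eq, hp.arg_zero, le_antisymm h (h0 ▸ hp.floor_nonneg)]
  · have h1 := hp.UM_le_tangent 0 h0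
    rw [← UM_eq, hp.arg_zero] at h1
    nlinarith [mul_nonneg (Real.rpow_pos_of_pos h0 (-p.bM)).le (sub_nonneg.2 h)]

theorem measurable_payoffI : Measurable p.payoffI := by
  unfold payoffI
  refine Measurable.ite ?_ (by fun_prop) (Measurable.ite ?_ (by fun_prop) (by fun_prop))
  · exact measurableSet_lt (by fun_prop) (by fun_prop)
  · exact measurableSet_lt (by fun_prop) (by fun_prop)

theorem measurable_UM : Measurable p.UM := by
  have := measurable_payoffI (p := p)
  unfold UM hara payoffM
  fun_prop

/-- `w` maximizes `U_M(v) - x v` over the region where `U_M` is concave and increasing. -/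
def IsUpperMax (p : Model) (x w : ℝ) : Prop :=
  (1 + p.m - p.c) * p.v₀ ≤ w ∧
    ∀ v, (1 + p.m - p.c) * p.v₀ ≤ v → p.UM v - x * v ≤ p.UM w - x * w

/-- The power function lies below its tangent at `arg w`, so maximality reduces to a linear
inequality for the piecewise affine `arg`. -/
theorem Admissible.isUpperMax_of_supergradient (hp : p.Admissible) {x w : ℝ}
    (hw : (1 + p.m - p.c) * p.v₀ ≤ w) (h0 : 0 < p.arg w)
    (h : ∀ v, (1 + p.m - p.c) * p.v₀ ≤ v →
      p.arg w ^ (-p.bM) * (p.arg v - p.arg w) ≤ x * (v - w)) : p.IsUpperMax x w := by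
  refine ⟨hw, fun v hv => ?_⟩
  have := hp.UM_le_tangent v h0
  rw [← UM_eq] at this
  linarith [h v hv]

theorem Admissible.inv₃_eq (hp : p.Admissible) {x : ℝ} (hx : 0 < x) :
    p.inv₃ 1 x = (1 + p.m) * p.v₀ + ((x / p.α) ^ (-1 / p.bM) - (p.m * p.v₀ + p.aM)) / p.α := by
  have hα := hp.α_pos
  have h1 : (x / p.α) ^ (-1 / p.bM) = p.α * (p.α ^ (1 / p.bM - 1) * x ^ (-1 / p.bM)) := by
    rw [div_eq_mul_inv, Real.mul_rpow hx.le (inv_pos.2 hα).le, Real.inv_rpow hα.le,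
      ← Real.rpow_neg hα.le, neg_div, neg_neg, Real.rpow_sub_one hα.ne']
    field_simp
  rw [inv₃, one_mul, h1]
  field_simp
  ring

theorem inv₂_eq (x : ℝ) :
    p.inv₂ 1 x = (1 + p.m) * p.v₀ + (x ^ (-1 / p.bM) - (p.m * p.v₀ + p.aM)) := by
  rw [inv₂, one_mul]
  ring

/-- The reference point `X` is the kink argument in Cases B and C. In Case A that number may be
zero, and `X` is the tangency point instead. -/
theorem Admissible.le_inv₃ (hp : p.Admissible) {x X : ℝ} (hx : 0 < x) (hX : 0 < X)
    (h : x ≤ p.α * X ^ (-p.bM)) (hBX : p.m * p.v₀ + p.aM ≤ X) :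
    (1 + p.m) * p.v₀ ≤ p.inv₃ 1 x := by
  have hα := hp.α_pos
  have h1 := le_rpow_neg_inv hp.bM_pos (div_pos hx hα) hX ((div_le_iff₀' hα).2 h)
  rw [hp.inv₃_eq hx]
  have := div_nonneg (sub_nonneg.2 (hBX.trans h1)) hα.le
  linarith

theorem Admissible.isUpperMax_inv₃ (hp : p.Admissible) {x X : ℝ} (hx : 0 < x) (hX : 0 < X)
    (h : x ≤ p.α * X ^ (-p.bM)) (hBX : p.m * p.v₀ + p.aM ≤ X) :
    p.IsUpperMax x (p.inv₃ 1 x) := by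
  have hα := hp.α_pos
  have hle := hp.le_inv₃ hx hX h hBX
  have harg : p.arg (p.inv₃ 1 x) = (x / p.α) ^ (-1 / p.bM) := by
    rw [hp.arg_of_le hle, hp.inv₃_eq hx]
    field_simp
    ring
  have h0 : 0 < (x / p.α) ^ (-1 / p.bM) := Real.rpow_pos_of_pos (div_pos hx hα) _
  refine hp.isUpperMax_of_supergradient (hp.flat_le_level.trans hle) (harg ▸ h0) fun v hv => ?_
  rw [harg, rpow_neg_inv_rpow_neg hp.bM_pos (div_pos hx hα)]
  have h2 := hp.arg_le_mul hv
  have h3 : p.α * (p.inv₃ 1 x - (1 + p.m) * p.v₀) =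
      (x / p.α) ^ (-1 / p.bM) - (p.m * p.v₀ + p.aM) := by
    rw [hp.inv₃_eq hx]
    field_simp
    ring
  calc x / p.α * (p.arg v - (x / p.α) ^ (-1 / p.bM))
      ≤ x / p.α * (p.α * (v - p.inv₃ 1 x)) :=
        mul_le_mul_of_nonneg_left (by linarith) (div_pos hx hα).le
    _ = x * (v - p.inv₃ 1 x) := by field_simp

theorem Admissible.arg_level (hp : p.Admissible) :
    p.arg ((1 + p.m) * p.v₀) = p.m * p.v₀ + p.aM := by
  rw [hp.arg_of_le le_rfl, sub_self, mul_zero, add_zero]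

/-- Every price between the right and left slopes of `UM` at the kink is a supergradient there. -/
theorem Admissible.isUpperMax_level (hp : p.Admissible) (hB : 0 < p.m * p.v₀ + p.aM) {x : ℝ}
    (h : p.α * (p.m * p.v₀ + p.aM) ^ (-p.bM) ≤ x) (h' : x ≤ (p.m * p.v₀ + p.aM) ^ (-p.bM)) :
    p.IsUpperMax x ((1 + p.m) * p.v₀) := by
  have hb := Real.rpow_pos_of_pos hB (-p.bM)
  refine hp.isUpperMax_of_supergradient hp.flat_le_level (hp.arg_level ▸ hB) fun v hv => ?_
  rw [hp.arg_level]
  rcases le_total v ((1 + p.m) * p.v₀) with h1 | h1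
  · rw [hp.arg_of_mem hv h1]
    nlinarith
  · rw [hp.arg_of_le h1]
    nlinarith

theorem Admissible.inv₂_mem (hp : p.Admissible) (hB : 0 < p.m * p.v₀ + p.aM) {x X : ℝ}
    (hx : 0 < x) (hX : 0 < X) (hAX : p.v₀ * (p.m - p.c) + p.aM ≤ X) (h : x ≤ X ^ (-p.bM))
    (h' : (p.m * p.v₀ + p.aM) ^ (-p.bM) ≤ x) :
    (1 + p.m - p.c) * p.v₀ ≤ p.inv₂ 1 x ∧ p.inv₂ 1 x ≤ (1 + p.m) * p.v₀ := by
  have h1 := le_rpow_neg_inv hp.bM_pos hx hX h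
  have h2 := rpow_neg_inv_le hp.bM_pos hB h'
  rw [inv₂_eq]
  constructor <;> linarith

theorem Admissible.isUpperMax_inv₂ (hp : p.Admissible) (hB : 0 < p.m * p.v₀ + p.aM) {x X : ℝ}
    (hx : 0 < x) (hX : 0 < X) (hAX : p.v₀ * (p.m - p.c) + p.aM ≤ X) (h : x ≤ X ^ (-p.bM))
    (h' : (p.m * p.v₀ + p.aM) ^ (-p.bM) ≤ x) : p.IsUpperMax x (p.inv₂ 1 x) := by
  obtain ⟨h1, h2⟩ := hp.inv₂_mem hB hx hX hAX h h'
  have harg : p.arg (p.inv₂ 1 x) = x ^ (-1 / p.bM) := by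
    rw [hp.arg_of_mem h1 h2, inv₂_eq]
    ring
  have h0 : 0 < x ^ (-1 / p.bM) := Real.rpow_pos_of_pos hx _
  refine hp.isUpperMax_of_supergradient h1 (harg ▸ h0) fun v hv => ?_
  rw [harg, rpow_neg_inv_rpow_neg hp.bM_pos hx]
  have h3 := hp.arg_le hv
  have h4 := inv₂_eq (p := p) x
  exact mul_le_mul_of_nonneg_left (by linarith) hx.le

theorem measurable_inv₃ : Measurable (p.inv₃ 1) := by
  unfold inv₃
  fun_prop

theorem measurable_inv₂ : Measurable (p.inv₂ 1) := by
  unfold inv₂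
  fun_prop

theorem Admissible.tendsto_inv₃ (hp : p.Admissible) :
    Filter.Tendsto (p.inv₃ 1) (nhdsWithin 0 (Set.Ioi 0)) Filter.atTop := by
  have h1 : Filter.Tendsto (fun x : ℝ => x ^ (-1 / p.bM)) (nhdsWithin 0 (Set.Ioi 0))
      Filter.atTop :=
    tendsto_rpow_neg_nhdsGT_zero (div_neg_of_neg_of_pos (by norm_num) hp.bM_pos)
  have h2 := Filter.tendsto_atTop_add_const_right _
    ((1 + p.m - p.α⁻¹ * p.m) * p.v₀ - p.α⁻¹ * p.aM)
    (h1.const_mul_atTop (Real.rpow_pos_of_pos hp.α_pos (1 / p.bM - 1)))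
  refine h2.congr fun x => ?_
  rw [inv₃, one_mul]
  ring

/-- The demand function obtained by switching at price `s` from `0` to maximizers above the flat
region, when at price `s` the manager is indifferent between the two. -/
theorem Admissible.isDemand (hp : p.Admissible) {g : ℝ → ℝ} {s q : ℝ} (hq : 0 < q) (hqs : q ≤ s)
    (hg : Measurable g) (hmax : ∀ x, 0 < x → x ≤ s → p.IsUpperMax x (g x))
    (hs : p.UM (g s) - s * g s = p.UM 0) (hzero : ∀ x, s < x → g x = 0)
    (hinv : ∀ x, 0 < x → x < q → g x = p.inv₃ 1 x)
    (hgrowth : ∃ C D : ℝ, 0 ≤ C ∧ 0 ≤ D ∧ ∀ x, 0 < x → x ≤ s → g x ≤ C * x ^ (-1 / p.bM) + D) :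
    IsDemand p.UM g s := by
  have hs0 : 0 < s := hq.trans_le hqs
  have hpos : ∀ x, 0 < x → x ≤ s → 0 < g x := fun x hx hxs =>
    hp.flat_pos.trans_le (hmax x hx hxs).1
  refine ⟨hs0, measurable_UM, hg, fun v _ => hp.UM_zero_le v, ?_, ?_,
    fun x hx hxs => hpos x hx hxs.le, hzero, ?_, ?_⟩
  · intro x hx
    rcases le_or_gt x s with h | h
    · exact (hpos x hx h).le
    · exact (hzero x h).ge
  · intro x hx v hv
    -- Indifference at `s` makes `g s` worth at least `UM 0` at every lower price. This settles the
    -- competitors in the flat region, where the utility equals `UM 0`.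
    have key : p.UM 0 ≤ p.UM (g x) - x * g x := by
      rcases le_or_gt x s with h | h
      · have h1 := (hmax x hx h).2 (g s) (hmax s hs0 le_rfl).1
        nlinarith [hpos s hs0 le_rfl]
      · rw [hzero x h, mul_zero, sub_zero]
    rcases lt_or_ge v ((1 + p.m - p.c) * p.v₀) with h | h
    · rw [hp.UM_of_lt h]
      nlinarith
    · rcases le_or_gt x s with h' | h'
      · exact (hmax x hx h').2 v h
      -- Above `s`, the line through `(0, UM 0)` of slope `s` dominates `UM`, so a steeper price
      -- leaves zero as the best choice.
      · have h1 := (hmax s hs0 le_rfl).2 v h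
        rw [hs] at h1
        nlinarith
  · obtain ⟨C, D, hC, hD, h⟩ := hgrowth
    refine ⟨C, D, -1 / p.bM, fun x hx => ?_⟩
    rcases le_or_gt x s with h' | h'
    · exact h x hx h'
    · rw [hzero x h']
      have := Real.rpow_pos_of_pos hx (-1 / p.bM)
      positivity
  · refine hp.tendsto_inv₃.congr' ?_
    filter_upwards [Ioo_mem_nhdsGT hq] with x hx
    exact (hinv x hx.1 hx.2).symm

/-- The constants are deliberately wasteful: one pair bounds `inv₃`, the kink level and `inv₂`, and
so serves as growth witness in all three cases. -/
theorem Admissible.inv₃_le (hp : p.Admissible) {x : ℝ} (hx : 0 < x) :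
    p.inv₃ 1 x ≤ (p.α ^ (1 / p.bM - 1) + 1) * x ^ (-1 / p.bM) +
      (|(1 + p.m - p.α⁻¹ * p.m) * p.v₀ - p.α⁻¹ * p.aM| + (1 + p.m) * p.v₀ + |p.v₀ - p.aM|) := by
  rw [inv₃, one_mul]
  have := Real.rpow_pos_of_pos hx (-1 / p.bM)
  linarith [le_abs_self ((1 + p.m - p.α⁻¹ * p.m) * p.v₀ - p.α⁻¹ * p.aM), hp.level_pos,
    abs_nonneg (p.v₀ - p.aM)]

theorem Admissible.level_le (hp : p.Admissible) {x : ℝ} (hx : 0 < x) :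
    (1 + p.m) * p.v₀ ≤ (p.α ^ (1 / p.bM - 1) + 1) * x ^ (-1 / p.bM) +
      (|(1 + p.m - p.α⁻¹ * p.m) * p.v₀ - p.α⁻¹ * p.aM| + (1 + p.m) * p.v₀ + |p.v₀ - p.aM|) := by
  have := Real.rpow_pos_of_pos hx (-1 / p.bM)
  have := mul_pos (add_pos (Real.rpow_pos_of_pos hp.α_pos (1 / p.bM - 1)) one_pos) this
  linarith [abs_nonneg ((1 + p.m - p.α⁻¹ * p.m) * p.v₀ - p.α⁻¹ * p.aM),
    abs_nonneg (p.v₀ - p.aM)]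

theorem Admissible.inv₂_le (hp : p.Admissible) {x : ℝ} (hx : 0 < x) :
    p.inv₂ 1 x ≤ (p.α ^ (1 / p.bM - 1) + 1) * x ^ (-1 / p.bM) +
      (|(1 + p.m - p.α⁻¹ * p.m) * p.v₀ - p.α⁻¹ * p.aM| + (1 + p.m) * p.v₀ + |p.v₀ - p.aM|) := by
  rw [inv₂, one_mul]
  have := mul_pos (Real.rpow_pos_of_pos hp.α_pos (1 / p.bM - 1))
    (Real.rpow_pos_of_pos hx (-1 / p.bM))
  linarith [abs_nonneg ((1 + p.m - p.α⁻¹ * p.m) * p.v₀ - p.α⁻¹ * p.aM), hp.level_pos,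
    le_abs_self (p.v₀ - p.aM)]

theorem Admissible.bound_nonneg (hp : p.Admissible) :
    0 ≤ p.α ^ (1 / p.bM - 1) + 1 ∧
    0 ≤ |(1 + p.m - p.α⁻¹ * p.m) * p.v₀ - p.α⁻¹ * p.aM| + (1 + p.m) * p.v₀ + |p.v₀ - p.aM| := by
  have := Real.rpow_pos_of_pos hp.α_pos (1 / p.bM - 1)
  have := hp.level_pos
  exact ⟨by positivity, by positivity⟩

/-- The demand function in Case A. -/
noncomputable def demandA (p : Model) (θ x : ℝ) : ℝ :=
  if x ≤ p.slopeA θ then p.inv₃ 1 x else 0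

/-- The demand function in Case B. -/
noncomputable def demandB (p : Model) (x : ℝ) : ℝ :=
  if x < p.α * (p.m * p.v₀ + p.aM) ^ (-p.bM) then p.inv₃ 1 x
  else if x ≤ p.H then (1 + p.m) * p.v₀ else 0

/-- The demand function in Case C. -/
noncomputable def demandC (p : Model) (θ x : ℝ) : ℝ :=
  if x < p.α * (p.m * p.v₀ + p.aM) ^ (-p.bM) then p.inv₃ 1 x
  else if x ≤ (p.m * p.v₀ + p.aM) ^ (-p.bM) then (1 + p.m) * p.v₀
  else if x ≤ p.slopeC θ then p.inv₂ 1 x else 0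

theorem Admissible.slopeA_pos (hp : p.Admissible) {θ : ℝ} (hθ : p.IsThetaA θ) :
    0 < p.slopeA θ :=
  mul_pos hp.α_pos (Real.rpow_pos_of_pos (hp.kink_nonneg.trans_lt (hp.isThetaA_iff.1 hθ).1) _)

theorem Admissible.isDemandA (hp : p.Admissible) {θ : ℝ} (hθ : p.IsThetaA θ) :
    IsDemand p.UM (p.demandA θ) (p.slopeA θ) := by
  obtain ⟨h1, h2⟩ := hp.isThetaA_iff.1 hθ
  have hs := hp.slopeA_pos hθ
  have hα := hp.α_pos
  set X := p.α * θ + (p.m - p.α * (1 + p.m)) * p.v₀ + p.aM with hX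
  have hX0 : 0 < X := hp.kink_nonneg.trans_lt h1
  have hsX : p.slopeA θ = p.α * X ^ (-p.bM) := rfl
  -- At the threshold price demand is `θ` itself, so indifference there becomes the tangency
  -- equation.
  have hval : p.inv₃ 1 (p.slopeA θ) = θ := by
    rw [hp.inv₃_eq hs, hsX, mul_div_cancel_left₀ _ hα.ne', rpow_neg_rpow_neg_inv hp.bM_pos hX0, hX]
    field_simp
    ring
  refine hp.isDemand hs le_rfl ?_ ?_ ?_ ?_ ?_ ?_
  · exact Measurable.ite measurableSet_Iic measurable_inv₃ measurable_const
  · intro x hx hxs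
    rw [demandA, if_pos hxs]
    exact hp.isUpperMax_inv₃ hx hX0 hxs h1.le
  · rw [demandA, if_pos le_rfl, hval, UM_eq, hp.UM_zero, ← h2,
      tangentIntercept_eq hp.bM_ne hX0, hp.arg_of_le hθ.1.le, hsX]
    have e1 : p.m * p.v₀ + p.aM + p.α * (θ - (1 + p.m) * p.v₀) = X := by
      rw [hX]
      ring
    have e2 : X + (p.α * ((1 + p.m) * p.v₀) - (p.m * p.v₀ + p.aM)) = p.α * θ := by
      rw [hX]
      ring
    rw [e1, e2]
    ring
  · intro x hx
    rw [demandA, if_neg hx.not_ge]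
  · intro x _ hx
    rw [demandA, if_pos hx.le]
  · refine ⟨_, _, hp.bound_nonneg.1, hp.bound_nonneg.2, fun x hx hxs => ?_⟩
    rw [demandA, if_pos hxs]
    exact hp.inv₃_le hx

theorem Admissible.isDemandB (hp : p.Admissible) (hB : p.CaseB) :
    IsDemand p.UM p.demandB p.H := by
  have hk : 0 < p.m * p.v₀ + p.aM := lt_of_le_of_ne hp.kink_nonneg hB.1.symm
  refine hp.isDemand (mul_pos hp.α_pos (Real.rpow_pos_of_pos hk (-p.bM))) hB.2.1 ?_ ?_ ?_ ?_ ?_ ?_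
  · exact Measurable.ite measurableSet_Iio measurable_inv₃
      (Measurable.ite measurableSet_Iic measurable_const measurable_const)
  · intro x hx hxs
    rw [demandB, if_pos hxs]
    split_ifs with h
    · exact hp.isUpperMax_inv₃ hx hk h.le le_rfl
    · exact hp.isUpperMax_level hk (not_lt.1 h) (hxs.trans hB.2.2)
  -- Indifference at price `H` is the definition of `H` as a chord slope.
  · rw [demandB, if_neg hB.2.1.not_gt, if_pos le_rfl, UM_eq, hp.arg_level, hp.UM_zero]
    linarith [hp.level_mul_H]
  · intro x hx
    rw [demandB, if_neg (hB.2.1.trans_lt hx).not_gt, if_neg hx.not_ge]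
  · intro x _ hx
    rw [demandB, if_pos hx]
  · refine ⟨_, _, hp.bound_nonneg.1, hp.bound_nonneg.2, fun x hx hxs => ?_⟩
    rw [demandB, if_pos hxs]
    split_ifs
    · exact hp.inv₃_le hx
    · exact hp.level_le hx

theorem Admissible.mul_rpow_kink_le (hp : p.Admissible) :
    p.α * (p.m * p.v₀ + p.aM) ^ (-p.bM) ≤ (p.m * p.v₀ + p.aM) ^ (-p.bM) :=
  mul_le_of_le_one_left (Real.rpow_nonneg hp.kink_nonneg _) hp.α_le_one

theorem Admissible.rpow_kink_lt_slopeC (hp : p.Admissible) {θ : ℝ} (hθ : p.IsThetaC θ) :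
    (p.m * p.v₀ + p.aM) ^ (-p.bM) < p.slopeC θ := by
  obtain ⟨h1, h3, -⟩ := hp.isThetaC_iff.1 hθ
  exact Real.rpow_lt_rpow_of_neg (hp.floor_nonneg.trans_lt h1) h3 (neg_lt_zero.2 hp.bM_pos)

theorem Admissible.isDemandC (hp : p.Admissible) (hC : p.CaseC) {θ : ℝ} (hθ : p.IsThetaC θ) :
    IsDemand p.UM (p.demandC θ) (p.slopeC θ) := by
  have hk : 0 < p.m * p.v₀ + p.aM := lt_of_le_of_ne hp.kink_nonneg hC.1.symm
  obtain ⟨h1, h3, h2⟩ := hp.isThetaC_iff.1 hθ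
  have hqs := hp.rpow_kink_lt_slopeC hθ
  have hqq := hp.mul_rpow_kink_le
  have hX0 : 0 < θ - p.v₀ + p.aM := hp.floor_nonneg.trans_lt h1
  have hval : p.inv₂ 1 (p.slopeC θ) = θ := by
    rw [inv₂_eq, slopeC, rpow_neg_rpow_neg_inv hp.bM_pos hX0]
    ring
  refine hp.isDemand (mul_pos hp.α_pos (Real.rpow_pos_of_pos hk (-p.bM))) (hqq.trans hqs.le)
    ?_ ?_ ?_ ?_ ?_ ?_
  · exact Measurable.ite measurableSet_Iio measurable_inv₃
      (Measurable.ite measurableSet_Iic measurable_const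
        (Measurable.ite measurableSet_Iic measurable_inv₂ measurable_const))
  · intro x hx hxs
    rw [demandC, if_pos hxs]
    split_ifs with h h'
    · exact hp.isUpperMax_inv₃ hx hk h.le le_rfl
    · exact hp.isUpperMax_level hk (not_lt.1 h) h'
    · exact hp.isUpperMax_inv₂ hk hx hX0 h1.le hxs (not_le.1 h').le
  · rw [demandC, if_neg (hqq.trans hqs.le).not_gt, if_neg hqs.not_ge, if_pos le_rfl, hval, UM_eq,
      hp.arg_of_mem hθ.1.le hθ.2.1.le, hp.UM_zero, ← h2, tangentIntercept_eq hp.bM_ne hX0, slopeC]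
    have e1 : p.m * p.v₀ + p.aM + (θ - (1 + p.m) * p.v₀) = θ - p.v₀ + p.aM := by ring
    rw [e1]
    ring
  · intro x hx
    rw [demandC, if_neg ((hqq.trans hqs.le).trans_lt hx).not_gt, if_neg (hqs.trans hx).not_ge,
      if_neg hx.not_ge]
  · intro x _ hx
    rw [demandC, if_pos hx]
  · refine ⟨_, _, hp.bound_nonneg.1, hp.bound_nonneg.2, fun x hx hxs => ?_⟩
    rw [demandC, if_pos hxs]
    split_ifs
    · exact hp.inv₃_le hx
    · exact hp.level_le hx
    · exact hp.inv₂_le hx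

end Model

end FirstLoss

/-! ### The investor's expected utility under the optimal fund value -/

namespace FirstLoss

namespace Model

variable {p : Model}

theorem inv₃_eq_one (y z : ℝ) : p.inv₃ y z = p.inv₃ 1 (y * z) := by
  rw [inv₃, inv₃, one_mul]

theorem inv₂_eq_one (y z : ℝ) : p.inv₂ y z = p.inv₂ 1 (y * z) := by
  rw [inv₂, inv₂, one_mul]

theorem Admissible.payoffI_inv₃ (hp : p.Admissible) {y z : ℝ} (hy : 0 < y) (hz : 0 < z)
    (h : (1 + p.m) * p.v₀ ≤ p.inv₃ 1 (y * z)) :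
    p.payoffI (p.inv₃ 1 (y * z)) + p.aI = p.k y * z ^ (-1 / p.bM) + p.l := by
  have hα := hp.α_pos.ne'
  rw [hp.payoffI_of_le h, inv₃, one_mul, Real.mul_rpow hy.le hz.le, k, l]
  field_simp
  ring

theorem Admissible.le_payoffI (hp : p.Admissible) {v : ℝ} (h : (1 + p.m) * p.v₀ ≤ v) :
    p.v₀ ≤ p.payoffI v := by
  rw [hp.payoffI_of_le h]
  nlinarith [hp.α_le_one]

/-- The lower bound on `aI` gives `v₀ + aI ≥ (1 + m - c) v₀`, positive because `c < 1 + m`. It keeps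
the base of the power away from zero in `integrable_truncated`. -/
theorem Admissible.investor_pos (hp : p.Admissible) : 0 < p.v₀ + p.aI := by
  have h := hp.flat_pos
  rcases hp.bI_ne.lt_or_gt with h1 | h1
  · linarith [hp.aI_of_lt h1]
  · linarith [hp.aI_of_gt h1]

/-- On the interval `[δ, ∞)` real powers with exponent less than `1` grow at most linearly. -/
theorem _root_.Real.rpow_le_one_add_add {b δ x : ℝ} (hb : 0 < b) (hδ : 0 < δ) (hx : δ ≤ x) :
    x ^ (1 - b) ≤ 1 + x + δ ^ (1 - b) := by
  have hx0 := hδ.trans_le hx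
  have hδ' := Real.rpow_pos_of_pos hδ (1 - b)
  rcases le_total b 1 with h | h
  · rcases le_total x 1 with h1 | h1
    · linarith [Real.rpow_le_one hx0.le h1 (sub_nonneg.2 h)]
    · have := Real.rpow_le_rpow_of_exponent_le h1 (by linarith : 1 - b ≤ 1)
      rw [Real.rpow_one] at this
      linarith
  · linarith [Real.rpow_le_rpow_of_nonpos hδ hx (sub_nonpos.2 h)]

variable {Ω : Type*} [mΩ : MeasurableSpace Ω] {Q : Measure Ω}
  {ℱ : Filtration ℝ≥0 mΩ} {W : ℝ≥0 → Ω → ℝ} {g : ℝ → ℝ} {s q y : ℝ}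

theorem mem_Ioo_div_iff {z : ℝ} (hy : 0 < y) (hz : 0 < z) :
    z ∈ Set.Ioo 0 (q / y) ↔ y * z < q := by
  rw [Set.mem_Ioo, lt_div_iff₀' hy, and_iff_right hz]

theorem Admissible.integrable_truncated [IsFiniteMeasure Q] (hp : p.Admissible)
    (hW : IsWienerOn p.T ℱ Q W)
    (hlow : ∀ x, 0 < x → x < q → g x = p.inv₃ 1 x ∧ (1 + p.m) * p.v₀ ≤ g x) (hy : 0 < y) :
    Integrable (p.truncated W y (Set.Ioo 0 (q / y))) Q := by
  have hZ := hp.isPriceDensity hW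
  have hm : Measurable (p.truncated W y (Set.Ioo 0 (q / y))) :=
    (Measurable.indicator (by fun_prop) measurableSet_Ioo).comp hZ.measurable
  have hδ := hp.investor_pos
  have hi : Integrable (fun ω => 1 + (|p.k y| * p.Z W p.T ω ^ (-1 / p.bM) + |p.l|)
      + (p.v₀ + p.aI) ^ (1 - p.bI)) Q :=
    ((integrable_const _).add (((hZ.moment _).const_mul _).add (integrable_const _))).add
      (integrable_const _)
  refine hi.mono' hm.aestronglyMeasurable (ae_of_all _ fun ω => ?_)
  have hz := hZ.pos ω
  have hze := Real.rpow_pos_of_pos hz (-1 / p.bM)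
  have hδ' := Real.rpow_pos_of_pos hδ (1 - p.bI)
  rw [truncated]
  by_cases h : p.Z W p.T ω ∈ Set.Ioo 0 (q / y)
  · obtain ⟨h1, h2⟩ := hlow _ (mul_pos hy hz) ((mem_Ioo_div_iff hy hz).1 h)
    rw [h1] at h2
    have h3 := hp.le_payoffI h2
    have h4 : p.v₀ + p.aI ≤ p.k y * p.Z W p.T ω ^ (-1 / p.bM) + p.l := by
      rw [← hp.payoffI_inv₃ hy hz h2]
      linarith
    rw [Set.indicator_of_mem h,
      Real.norm_of_nonneg (Real.rpow_nonneg (hδ.le.trans h4) _)]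
    refine (Real.rpow_le_one_add_add hp.bI_pos hδ h4).trans ?_
    have := mul_le_mul_of_nonneg_right (le_abs_self (p.k y)) hze.le
    linarith [le_abs_self p.l]
  · rw [Set.indicator_of_notMem h, norm_zero]
    positivity

/-- The prices `q` and `s` are hit with probability zero. The middle range is written as a
difference of two upper tails, so that integration gives a difference of values of `Phi`. -/
theorem Admissible.UI_demand_ae_eq (hp : p.Admissible) (hW : IsWienerOn p.T ℱ Q W)
    (h : IsDemand p.UM g s) (hqs : q ≤ s)
    (hlow : ∀ x, 0 < x → x < q → g x = p.inv₃ 1 x ∧ (1 + p.m) * p.v₀ ≤ g x)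
    (hmid : ∀ x, q < x → x < s → p.payoffI (g x) = p.v₀) (hy : 0 < y) :
    (fun ω => p.UI (g (y * p.Z W p.T ω))) =ᵐ[Q] fun ω =>
      {ω | s < y * p.Z W p.T ω}.indicator
        (fun _ => (1 - p.bI)⁻¹ * (p.v₀ * (p.c - p.m) + p.aI) ^ (1 - p.bI)) ω
      + (1 - p.bI)⁻¹ * p.truncated W y (Set.Ioo 0 (q / y)) ω
      + ({ω | q < y * p.Z W p.T ω}.indicator
          (fun _ => (1 - p.bI)⁻¹ * (p.v₀ + p.aI) ^ (1 - p.bI)) ω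
        - {ω | s < y * p.Z W p.T ω}.indicator
          (fun _ => (1 - p.bI)⁻¹ * (p.v₀ + p.aI) ^ (1 - p.bI)) ω) := by
  have hZ := hp.isPriceDensity hW
  filter_upwards [hZ.ae_mul_ne hy s, hZ.ae_mul_ne hy q] with ω hs hq
  have hz := hZ.pos ω
  have hiff := mem_Ioo_div_iff (q := q) hy hz
  simp only [Set.indicator_apply, Set.mem_ofPred_eq, truncated, hiff, UI, hara, one_div]
  rcases hq.lt_or_gt with h1 | h1
  · obtain ⟨h2, h3⟩ := hlow _ (mul_pos hy hz) h1
    rw [h2] at h3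
    rw [if_neg (h1.trans_le hqs).not_gt, if_pos h1, if_neg h1.not_gt,
      if_neg (h1.trans_le hqs).not_gt, h2, hp.payoffI_inv₃ hy hz h3]
    ring
  rcases hs.lt_or_gt with h2 | h2
  · rw [if_neg h2.not_gt, if_neg h1.not_gt, if_pos h1, if_neg h2.not_gt, hmid _ h1 h2]
    ring
  · rw [if_pos h2, if_neg h1.not_gt, if_pos h1, if_pos h2, h.zero _ h2, payoffI_of_lt hp.flat_pos]
    ring_nf

/-- The investor's value for a demand function which is interior below the price `q`, leaves the
investor with `v₀` between `q` and `s`, and vanishes above `s`. -/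
theorem Admissible.investorValueEq [IsProbabilityMeasure Q] (hp : p.Admissible)
    (hW : IsWienerOn p.T ℱ Q W)
    (h : IsDemand p.UM g s) (hq : 0 < q) (hqs : q ≤ s)
    (hlow : ∀ x, 0 < x → x < q → g x = p.inv₃ 1 x ∧ (1 + p.m) * p.v₀ ≤ g x)
    (hmid : ∀ x, q < x → x < s → p.payoffI (g x) = p.v₀) (hy : 0 < y)
    (hb : ∫ ω, p.Z W p.T ω * g (y * p.Z W p.T ω) ∂Q = p.v₀) :
    p.InvestorValueEq ℱ Q W
      ((1 - p.bI)⁻¹ * (p.v₀ * (p.c - p.m) + p.aI) ^ (1 - p.bI) * Phi (p.d y s)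
        + (1 - p.bI)⁻¹ * ∫ ω, p.truncated W y (Set.Ioo 0 (q / y)) ω ∂Q
        + (1 - p.bI)⁻¹ * (p.v₀ + p.aI) ^ (1 - p.bI) * (Phi (p.d y q) - Phi (p.d y s))) := by
  intro V hV
  have hZ := hp.isPriceDensity hW
  have hVg : (fun ω => p.UI (V ω)) =ᵐ[Q] fun ω => p.UI (g (y * p.Z W p.T ω)) :=
    (hV.ae_eq_demand h hZ (measurable_Z_of_isWienerOn hW) hp.v₀_pos hy hb).mono
      fun ω hω => congrArg p.UI hω
  have hae := hVg.trans (hp.UI_demand_ae_eq hW h hqs hlow hmid hy)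
  have hm : ∀ x, MeasurableSet {ω | x < y * p.Z W p.T ω} := fun x =>
    measurableSet_lt measurable_const (hZ.measurable.const_mul y)
  have hi : ∀ x c : ℝ, Integrable ({ω | x < y * p.Z W p.T ω}.indicator fun _ => c) Q :=
    fun x c => (integrable_const c).indicator (hm x)
  have hI : ∀ x c : ℝ, 0 < x →
      ∫ ω, {ω | x < y * p.Z W p.T ω}.indicator (fun _ => c) ω ∂Q = c * Phi (p.d y x) := by
    intro x c hx
    rw [integral_indicator_const c (hm x), hp.measureReal_lt_Z hW hx hy, smul_eq_mul, mul_comm]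
  have ht := (hp.integrable_truncated hW hlow hy).const_mul (1 - p.bI)⁻¹
  have hs := hq.trans_le hqs
  refine ⟨(((hi _ _).add ht).add ((hi _ _).sub (hi _ _))).congr hae.symm, ?_⟩
  rw [integral_congr_ae hae, integral_add (by exact (hi _ _).add ht)
      (by exact (hi _ _).sub (hi _ _)), integral_add (hi _ _) ht, integral_sub (hi _ _) (hi _ _),
    hI _ _ hs, hI _ _ hq, hI _ _ hs, integral_const_mul]
  ring

theorem Admissible.isMultiplier_iff [IsFiniteMeasure Q] (hp : p.Admissible)
    (hW : IsWienerOn p.T ℱ Q W) (h : IsDemand p.UM g s) {v : ℝ → ℝ → ℝ}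
    (hv : ∀ y, 0 < y → ∀ᵐ ω ∂Q, v y (p.Z W p.T ω) = g (y * p.Z W p.T ω)) :
    p.IsMultiplier Q W v y ↔
      0 < y ∧ ∫ ω, p.Z W p.T ω * g (y * p.Z W p.T ω) ∂Q = p.v₀ := by
  refine and_congr_right fun hy => ?_
  have hae : (fun ω => p.Z W p.T ω * v y (p.Z W p.T ω)) =ᵐ[Q]
      fun ω => p.Z W p.T ω * g (y * p.Z W p.T ω) := (hv y hy).mono fun ω hω => by simp only [hω]
  rw [integral_congr_ae hae, integrable_congr hae]
  exact and_iff_right (h.integrable_mul_comp (hp.isPriceDensity hW) hy)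

theorem Admissible.existsUnique_isMultiplier [IsFiniteMeasure Q] (hp : p.Admissible)
    (hW : IsWienerOn p.T ℱ Q W)
    (h : IsDemand p.UM g s) {v : ℝ → ℝ → ℝ}
    (hv : ∀ y, 0 < y → ∀ᵐ ω ∂Q, v y (p.Z W p.T ω) = g (y * p.Z W p.T ω)) :
    ∃! y, p.IsMultiplier Q W v y := by
  simp only [hp.isMultiplier_iff hW h hv]
  exact h.existsUnique_budget_eq (hp.isPriceDensity hW) hp.v₀_pos

theorem Admissible.exists_isOptimal [IsFiniteMeasure Q] (hp : p.Admissible)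
    (hW : IsWienerOn p.T ℱ Q W)
    (h : IsDemand p.UM g s) : ∃ V : Ω → ℝ, p.IsOptimal ℱ Q W V := by
  obtain ⟨y, ⟨hy, hb⟩, -⟩ := h.existsUnique_budget_eq (hp.isPriceDensity hW) hp.v₀_pos
  exact ⟨_, isOptimal_demand h (hp.isPriceDensity hW) (measurable_Z_of_isWienerOn hW) hp.v₀_pos
    hy hb⟩

theorem Admissible.valueA_ae_eq (hp : p.Admissible) (hW : IsWienerOn p.T ℱ Q W) (θ : ℝ)
    (hy : 0 < y) :
    ∀ᵐ ω ∂Q, p.valueA θ y (p.Z W p.T ω) = p.demandA θ (y * p.Z W p.T ω) := by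
  refine ae_of_all _ fun ω => ?_
  have hz := (hp.isPriceDensity hW).pos ω
  simp only [valueA, demandA, Set.indicator_apply, Set.mem_Ioc, hz, true_and, le_div_iff₀' hy,
    ← inv₃_eq_one]

theorem Admissible.valueB_ae_eq (hp : p.Admissible) (hW : IsWienerOn p.T ℱ Q W) (hy : 0 < y) :
    ∀ᵐ ω ∂Q, p.valueB y (p.Z W p.T ω) = p.demandB (y * p.Z W p.T ω) := by
  refine ae_of_all _ fun ω => ?_
  have hz := (hp.isPriceDensity hW).pos ω
  simp only [valueB, demandB, Set.indicator_apply, Set.mem_Ioo, Set.mem_Icc, hz, true_and,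
    le_div_iff₀' hy, lt_div_iff₀' hy, div_le_iff₀' hy, ← inv₃_eq_one]
  rcases lt_or_ge (y * p.Z W p.T ω) (p.α * (p.m * p.v₀ + p.aM) ^ (-p.bM)) with h | h
  · simp [h, h.not_ge]
  · simp [h, h.not_gt]

/-- Equality is only almost sure: at `y * Z = (m v₀ + aM) ^ (-bM)` all indicators of `valueC`
vanish, whereas `demandC` takes the kink level. -/
theorem Admissible.valueC_ae_eq (hp : p.Admissible) (hW : IsWienerOn p.T ℱ Q W) (θ : ℝ)
    (hy : 0 < y) :
    ∀ᵐ ω ∂Q, p.valueC θ y (p.Z W p.T ω) = p.demandC θ (y * p.Z W p.T ω) := by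
  filter_upwards [(hp.isPriceDensity hW).ae_mul_ne hy ((p.m * p.v₀ + p.aM) ^ (-p.bM))] with ω hne
  have hz := (hp.isPriceDensity hW).pos ω
  have hqq := hp.mul_rpow_kink_le
  simp only [valueC, demandC, Set.indicator_apply, Set.mem_Ioo, Set.mem_Ico, Set.mem_Ioc, hz,
    true_and, le_div_iff₀' hy, lt_div_iff₀' hy, div_le_iff₀' hy, div_lt_iff₀' hy, ← inv₃_eq_one,
    ← inv₂_eq_one]
  rcases hne.lt_or_gt with h1 | h1
  · rcases lt_or_ge (y * p.Z W p.T ω) (p.α * (p.m * p.v₀ + p.aM) ^ (-p.bM)) with h | h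
    · simp [h, h.not_ge, h1.not_gt]
    · simp [h, h.not_gt, h1, h1.le, h1.not_gt]
  · have h := hqq.trans_lt h1
    simp [h.not_gt, h1.not_gt, h1, h1.not_ge]

theorem caseA_or_caseB_or_caseC (p : Model) : p.CaseA ∨ p.CaseB ∨ p.CaseC := by
  by_cases h : p.m * p.v₀ + p.aM = 0
  · exact Or.inl (Or.inl h)
  rcases lt_or_ge p.H (p.α * (p.m * p.v₀ + p.aM) ^ (-p.bM)) with h1 | h1
  · exact Or.inl (Or.inr h1)
  rcases le_or_gt p.H ((p.m * p.v₀ + p.aM) ^ (-p.bM)) with h2 | h2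
  · exact Or.inr (Or.inl ⟨h, h1, h2⟩)
  · exact Or.inr (Or.inr ⟨h, h2⟩)

theorem Admissible.exists_isDemand (hp : p.Admissible) :
    ∃ (g : ℝ → ℝ) (s : ℝ), IsDemand p.UM g s := by
  rcases caseA_or_caseB_or_caseC p with h | h | h
  · obtain ⟨θ, hθ, -⟩ := hp.existsUnique_isThetaA h
    exact ⟨_, _, hp.isDemandA hθ⟩
  · exact ⟨_, _, hp.isDemandB h⟩
  · obtain ⟨θ, hθ, -⟩ := hp.existsUnique_isThetaC h
    exact ⟨_, _, hp.isDemandC h hθ⟩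

theorem Admissible.truncated_Ioc_ae_eq (hp : p.Admissible) (hW : IsWienerOn p.T ℱ Q W)
    (hy : 0 < y) : p.truncated W y (Set.Ioc 0 (s / y)) =ᵐ[Q]
      p.truncated W y (Set.Ioo 0 (s / y)) := by
  filter_upwards [(hp.isPriceDensity hW).ae_mul_ne hy s] with ω hne
  have : p.Z W p.T ω ≠ s / y := fun h => hne (by rw [h, mul_div_cancel₀ _ hy.ne'])
  simp only [truncated, Set.indicator_apply, Set.mem_Ioc, Set.mem_Ioo, this.le_iff_lt]

end Model

end FirstLoss

/-! ### The value formulas in the three cases -/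

open FirstLoss FirstLoss.Model in
theorem investorValue_caseA {Ω : Type*} [mΩ : MeasurableSpace Ω] {Q : Measure Ω}
    [IsProbabilityMeasure Q] {p : FirstLoss.Model} (hp : p.Admissible)
    {ℱ : Filtration ℝ≥0 mΩ} {W : ℝ≥0 → Ω → ℝ} (hW : FirstLoss.IsWienerOn p.T ℱ Q W)
    {θ y : ℝ} (hθ : p.IsThetaA θ) (hy : p.IsMultiplier Q W (p.valueA θ) y) :
    Integrable (p.truncated W y (Set.Ioc 0 (p.slopeA θ / y))) Q ∧
      p.InvestorValueEq ℱ Q W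
        ((1 - p.bI)⁻¹ * (p.v₀ * (p.c - p.m) + p.aI) ^ (1 - p.bI) *
            FirstLoss.Phi (p.d y (p.slopeA θ))
          + (1 - p.bI)⁻¹ * ∫ ω, p.truncated W y (Set.Ioc 0 (p.slopeA θ / y)) ω ∂Q) := by
  have hD := hp.isDemandA hθ
  obtain ⟨hy0, hb⟩ := (hp.isMultiplier_iff hW hD fun y hy => hp.valueA_ae_eq hW θ hy).1 hy
  have hae := hp.truncated_Ioc_ae_eq hW (s := p.slopeA θ) hy0
  have hX := (hp.isThetaA_iff.1 hθ).1
  have hlow : ∀ x, 0 < x → x < p.slopeA θ →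
      p.demandA θ x = p.inv₃ 1 x ∧ (1 + p.m) * p.v₀ ≤ p.demandA θ x := by
    intro x hx hxs
    rw [demandA, if_pos hxs.le]
    exact ⟨rfl, hp.le_inv₃ hx (hp.kink_nonneg.trans_lt hX) hxs.le hX.le⟩
  -- Here `q = s`, so the middle range is empty and the last term cancels.
  have hval := hp.investorValueEq hW hD (hp.slopeA_pos hθ) le_rfl hlow
    (fun x h1 h2 => absurd h1 h2.not_gt) hy0 hb
  rw [sub_self, mul_zero, add_zero, ← integral_congr_ae hae] at hval
  exact ⟨(hp.integrable_truncated hW hlow hy0).congr hae.symm, hval⟩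

open FirstLoss FirstLoss.Model in
theorem investorValue_caseB {Ω : Type*} [mΩ : MeasurableSpace Ω] {Q : Measure Ω}
    [IsProbabilityMeasure Q] {p : FirstLoss.Model} (hp : p.Admissible)
    {ℱ : Filtration ℝ≥0 mΩ} {W : ℝ≥0 → Ω → ℝ} (hW : FirstLoss.IsWienerOn p.T ℱ Q W)
    (hB : p.CaseB) {y : ℝ} (hy : p.IsMultiplier Q W p.valueB y) :
    Integrable (p.truncated W y
        (Set.Ioo 0 (p.α * (p.m * p.v₀ + p.aM) ^ (-p.bM) / y))) Q ∧
      p.InvestorValueEq ℱ Q W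
        ((1 - p.bI)⁻¹ * (p.v₀ * (p.c - p.m) + p.aI) ^ (1 - p.bI) *
            FirstLoss.Phi (p.d y p.H)
          + (1 - p.bI)⁻¹ * ∫ ω, p.truncated W y
              (Set.Ioo 0 (p.α * (p.m * p.v₀ + p.aM) ^ (-p.bM) / y)) ω ∂Q
          + (1 - p.bI)⁻¹ * (p.v₀ + p.aI) ^ (1 - p.bI) *
              (FirstLoss.Phi (p.d y (p.α * (p.m * p.v₀ + p.aM) ^ (-p.bM)))
                - FirstLoss.Phi (p.d y p.H))) := by
  have hD := hp.isDemandB hB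
  obtain ⟨hy0, hb⟩ := (hp.isMultiplier_iff hW hD fun y hy => hp.valueB_ae_eq hW hy).1 hy
  have hk : 0 < p.m * p.v₀ + p.aM := lt_of_le_of_ne hp.kink_nonneg hB.1.symm
  have hlow : ∀ x, 0 < x → x < p.α * (p.m * p.v₀ + p.aM) ^ (-p.bM) →
      p.demandB x = p.inv₃ 1 x ∧ (1 + p.m) * p.v₀ ≤ p.demandB x := by
    intro x hx hxs
    rw [demandB, if_pos hxs]
    exact ⟨rfl, hp.le_inv₃ hx hk hxs.le le_rfl⟩
  refine ⟨hp.integrable_truncated hW hlow hy0, hp.investorValueEq hW hD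
    (mul_pos hp.α_pos (Real.rpow_pos_of_pos hk _)) hB.2.1 hlow (fun x h1 h2 => ?_) hy0 hb⟩
  rw [demandB, if_neg h1.not_gt, if_pos h2.le, hp.payoffI_of_le le_rfl]
  ring

open FirstLoss FirstLoss.Model in
theorem investorValue_caseC {Ω : Type*} [mΩ : MeasurableSpace Ω] {Q : Measure Ω}
    [IsProbabilityMeasure Q] {p : FirstLoss.Model} (hp : p.Admissible)
    {ℱ : Filtration ℝ≥0 mΩ} {W : ℝ≥0 → Ω → ℝ} (hW : FirstLoss.IsWienerOn p.T ℱ Q W)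
    (hC : p.CaseC) {θ y : ℝ} (hθ : p.IsThetaC θ) (hy : p.IsMultiplier Q W (p.valueC θ) y) :
    Integrable (p.truncated W y
        (Set.Ioo 0 (p.α * (p.m * p.v₀ + p.aM) ^ (-p.bM) / y))) Q ∧
      p.InvestorValueEq ℱ Q W
        ((1 - p.bI)⁻¹ * (p.v₀ * (p.c - p.m) + p.aI) ^ (1 - p.bI) *
            FirstLoss.Phi (p.d y (p.slopeC θ))
          + (1 - p.bI)⁻¹ * ∫ ω, p.truncated W y
              (Set.Ioo 0 (p.α * (p.m * p.v₀ + p.aM) ^ (-p.bM) / y)) ω ∂Q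
          + (1 - p.bI)⁻¹ * (p.v₀ + p.aI) ^ (1 - p.bI) *
              (FirstLoss.Phi (p.d y (p.α * (p.m * p.v₀ + p.aM) ^ (-p.bM)))
                - FirstLoss.Phi (p.d y (p.slopeC θ)))) := by
  have hD := hp.isDemandC hC hθ
  obtain ⟨hy0, hb⟩ := (hp.isMultiplier_iff hW hD fun y hy => hp.valueC_ae_eq hW θ hy).1 hy
  have hk : 0 < p.m * p.v₀ + p.aM := lt_of_le_of_ne hp.kink_nonneg hC.1.symm
  have hq : 0 < p.α * (p.m * p.v₀ + p.aM) ^ (-p.bM) :=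
    mul_pos hp.α_pos (Real.rpow_pos_of_pos hk _)
  have hlow : ∀ x, 0 < x → x < p.α * (p.m * p.v₀ + p.aM) ^ (-p.bM) →
      p.demandC θ x = p.inv₃ 1 x ∧ (1 + p.m) * p.v₀ ≤ p.demandC θ x := by
    intro x hx hxs
    rw [demandC, if_pos hxs]
    exact ⟨rfl, hp.le_inv₃ hx hk hxs.le le_rfl⟩
  have hlevel : p.payoffI ((1 + p.m) * p.v₀) = p.v₀ := by
    rw [hp.payoffI_of_le le_rfl]
    ring
  refine ⟨hp.integrable_truncated hW hlow hy0, hp.investorValueEq hW hD hq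
    (hp.mul_rpow_kink_le.trans (hp.rpow_kink_lt_slopeC hθ).le) hlow (fun x h1 h2 => ?_) hy0 hb⟩
  rw [demandC, if_neg h1.not_gt, if_pos h2.le]
  split_ifs with h
  · exact hlevel
  · obtain ⟨hX, -, -⟩ := hp.isThetaC_iff.1 hθ
    obtain ⟨h3, h4⟩ := hp.inv₂_mem hk (hq.trans h1) (hp.floor_nonneg.trans_lt hX) hX.le h2.le
      (not_le.1 h).le
    -- The branch of `payoffI` changes at the kink level, but both branches give `v₀` there.
    rcases h4.lt_or_eq with h4 | h4
    · exact payoffI_of_mem h3 h4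
    · rw [h4, hlevel]

theorem mainTheorem5 {Ω : Type*} [mΩ : MeasurableSpace Ω] (Q : Measure Ω)
    [IsProbabilityMeasure Q] (p : FirstLoss.Model) (hp : p.Admissible)
    (ℱ : Filtration ℝ≥0 mΩ) (W : ℝ≥0 → Ω → ℝ) (hW : FirstLoss.IsWienerOn p.T ℱ Q W) :
    (∃ V : Ω → ℝ, p.IsOptimal ℱ Q W V) ∧
    (p.CaseA →
      (∃! θ : ℝ, p.IsThetaA θ) ∧
      ∀ θ : ℝ, p.IsThetaA θ →
        (∃! y : ℝ, p.IsMultiplier Q W (p.valueA θ) y) ∧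
        ∀ y : ℝ, p.IsMultiplier Q W (p.valueA θ) y →
          Integrable (p.truncated W y (Set.Ioc 0 (p.slopeA θ / y))) Q ∧
          p.InvestorValueEq ℱ Q W
            ((1 - p.bI)⁻¹ * (p.v₀ * (p.c - p.m) + p.aI) ^ (1 - p.bI) *
                FirstLoss.Phi (p.d y (p.slopeA θ))
              + (1 - p.bI)⁻¹ * ∫ ω, p.truncated W y (Set.Ioc 0 (p.slopeA θ / y)) ω ∂Q)) ∧
    (p.CaseB →
      (∃! y : ℝ, p.IsMultiplier Q W p.valueB y) ∧
      ∀ y : ℝ, p.IsMultiplier Q W p.valueB y →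
        Integrable (p.truncated W y
          (Set.Ioo 0 (p.α * (p.m * p.v₀ + p.aM) ^ (-p.bM) / y))) Q ∧
        p.InvestorValueEq ℱ Q W
          ((1 - p.bI)⁻¹ * (p.v₀ * (p.c - p.m) + p.aI) ^ (1 - p.bI) *
              FirstLoss.Phi (p.d y p.H)
            + (1 - p.bI)⁻¹ * ∫ ω, p.truncated W y
                (Set.Ioo 0 (p.α * (p.m * p.v₀ + p.aM) ^ (-p.bM) / y)) ω ∂Q
            + (1 - p.bI)⁻¹ * (p.v₀ + p.aI) ^ (1 - p.bI) *
                (FirstLoss.Phi (p.d y (p.α * (p.m * p.v₀ + p.aM) ^ (-p.bM)))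
                  - FirstLoss.Phi (p.d y p.H)))) ∧
    (p.CaseC →
      (∃! θ : ℝ, p.IsThetaC θ) ∧
      ∀ θ : ℝ, p.IsThetaC θ →
        (∃! y : ℝ, p.IsMultiplier Q W (p.valueC θ) y) ∧
        ∀ y : ℝ, p.IsMultiplier Q W (p.valueC θ) y →
          Integrable (p.truncated W y
            (Set.Ioo 0 (p.α * (p.m * p.v₀ + p.aM) ^ (-p.bM) / y))) Q ∧
          p.InvestorValueEq ℱ Q W
            ((1 - p.bI)⁻¹ * (p.v₀ * (p.c - p.m) + p.aI) ^ (1 - p.bI) *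
                FirstLoss.Phi (p.d y (p.slopeC θ))
              + (1 - p.bI)⁻¹ * ∫ ω, p.truncated W y
                  (Set.Ioo 0 (p.α * (p.m * p.v₀ + p.aM) ^ (-p.bM) / y)) ω ∂Q
              + (1 - p.bI)⁻¹ * (p.v₀ + p.aI) ^ (1 - p.bI) *
                  (FirstLoss.Phi (p.d y (p.α * (p.m * p.v₀ + p.aM) ^ (-p.bM)))
                    - FirstLoss.Phi (p.d y (p.slopeC θ))))) := by
  obtain ⟨g, s, hg⟩ := hp.exists_isDemand
  refine ⟨hp.exists_isOptimal hW hg, fun hA => ⟨hp.existsUnique_isThetaA hA, fun θ hθ =>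
    ⟨hp.existsUnique_isMultiplier hW (hp.isDemandA hθ) fun y hy => hp.valueA_ae_eq hW θ hy,
      fun y hy => investorValue_caseA hp hW hθ hy⟩⟩,
    fun hB => ⟨hp.existsUnique_isMultiplier hW (hp.isDemandB hB) fun y hy => hp.valueB_ae_eq hW hy,
      fun y hy => investorValue_caseB hp hW hB hy⟩,
    fun hC => ⟨hp.existsUnique_isThetaC hC, fun θ hθ =>
      ⟨hp.existsUnique_isMultiplier hW (hp.isDemandC hC hθ) fun y hy => hp.valueC_ae_eq hW θ hy,
        fun y hy => investorValue_caseC hp hW hC hθ hy⟩⟩⟩
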